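/- Let $V$ be a real vector space of finite dimension $r$, let $(\cdot,\cdot)$ be a scalar product on $V^*$, and let $\alpha_1,\dots,\alpha_n\in V^*$ be a list of (not necessarily distinct) non-zero vectors that is polarized: there is a connected component $\Lambda$ of $V\setminus\bigcup_{i}\{v:\alpha_i(v)=0\}$ such that every $\alpha_i$ is positive on $\Lambda$. Write $\mathrm{Cone}(\alpha_i\mid i\in J)$ for the set of combinations of the $\alpha_i$, $i\in J$, with nonnegative coefficients. Let $\varepsilon\in V^*$ be regular, i.e. $\varepsilon$ lies on no subspace of $V^*$ of dimension at most $r-1$ that is spanned by a subset of $\{\alpha_1,\dots,\alpha_n\}$. Let $R$ be the algebra of rational functions $P/\prod_i\alpha_i^{m_i}$ with $P\in\mathbb{R}[V]$ and $m_i\ge 0$. Let $NG\subset R$ be the span of those fractions $P/\prod_i\alpha_i^{m_i}$ for which $\{\alpha_i\mid m_i>0\}$ does not span $V^*$, and for $d\ge 0$ let $G_{-d}\subset R$ be the span of those fractions $1/\prod_i\alpha_i^{m_i}$ for which $\{\alpha_i\mid m_i>0\}$ spans $V^*$ and $\sum_i m_i=d$. Then there is exactly one linear functional $\mathrm{JK}_\varepsilon:R\to\mathbb{R}$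 that vanishes on $NG$ and on $G_{-d}$ for all $d\ne r$, and that satisfies, for all indices $i_1,\dots,i_r$ such that $\alpha_{i_1},\dots,\alpha_{i_r}$ is a basis of $V^*$, $$\mathrm{JK}_\varepsilon\Big(\frac{1}{\alpha_{i_1}\cdots\alpha_{i_r}}\Big)=\begin{cases}\det\big[(\alpha_{i_k},\alpha_{i_l})\big]_{k,l=1}^{r}{}^{-1/2} & \text{if }\varepsilon\in\mathrm{Cone}(\alpha_{i_1},\dots,\alpha_{i_r}),\\ 0&\text{otherwise.}\end{cases}$$ Let $\mathcal{I}\subset\mathbb{R}[V]$ be the ideal generated by the products $\prod_{j\in J}\alpha_j$ over all $J\subset\{1,\dots,n\}$ with $\varepsilon\notin\mathrm{Cone}(\alpha_i\mid i\notin J)$. Then: 1. The ideal $\mathcal{I}$ is homogeneous, and for every homogeneous polynomial $P\in\mathbb{R}[V]$ of degree $n-r$ (where $n\ge r$), $$\mathrm{JK}_\varepsilon\Big(\frac{P}{\prod_{i=1}^n\alpha_i}\Big)=0\quad\Longleftrightarrow\quad P\in\mathcal{I}.$$ 2. If $\alpha_1,\dots,\alpha_n$ span $V^*$ (in particular, if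 $\varepsilon\in\mathrm{Cone}(\alpha_1,\dots,\alpha_n)$), then $\mathcal{I}$ is also the ideal generated by the products $\prod_{i:\,\alpha_i\in H^+}\alpha_i$, where $H$ runs over the hyperplanes of $V^*$ spanned by subsets of $\{\alpha_1,\dots,\alpha_n\}$ and $H^+$ is the open half-space of $H$ that contains $\varepsilon$. -/

import Mathlib

namespace JeffreyKirwan

noncomputable section

open Module

variable {V : Type*} [AddCommGroup V] [Module ℝ V]

/-- The algebra `ℝ[V]` of polynomials on `V`, i.e. the symmetric algebra of `V*`. -/
abbrev Poly (V : Type*) [AddCommGroup V] [Module ℝ V] : Type _ :=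
  SymmetricAlgebra ℝ (Dual ℝ V)

/-- A linear function on `V`, viewed as a polynomial on `V`. -/
abbrev lin (β : Dual ℝ V) : Poly V := SymmetricAlgebra.ι ℝ (Dual ℝ V) β

/-- The space `ℝ[V]_d` of homogeneous polynomials of degree `d`: the span of all products of
`d` linear functions. -/
def homogeneousPart (V : Type*) [AddCommGroup V] [Module ℝ V] (d : ℕ) : Submodule ℝ (Poly V) :=
  LinearMap.range (SymmetricAlgebra.ι ℝ (Dual ℝ V)) ^ d

/-- An ideal of `ℝ[V]` is homogeneous if it is generated by its homogeneous elements. -/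
def IsHomogeneousIdeal (I : Ideal (Poly V)) : Prop :=
  I = Ideal.span {p : Poly V | p ∈ I ∧ ∃ d : ℕ, p ∈ homogeneousPart V d}

variable {n : ℕ}

/-- `Cone(α_i | i ∈ J)`: the combinations of the `α_i`, `i ∈ J`, with nonnegative coefficients. -/
def cone (α : Fin n → Dual ℝ V) (J : Set (Fin n)) : PointedCone ℝ (Dual ℝ V) :=
  PointedCone.hull ℝ (α '' J)

/-- The linear subspace of `V*` spanned by the `α_i`, `i ∈ J`. -/
def spanOf (α : Fin n → Dual ℝ V) (J : Set (Fin n)) : Submodule ℝ (Dual ℝ V) :=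
  Submodule.span ℝ (α '' J)

/-- `J` is generating if the `α_j`, `j ∈ J`, span `V*`. -/
def IsGenerating (α : Fin n → Dual ℝ V) (J : Set (Fin n)) : Prop :=
  spanOf α J = ⊤

/-- `J` indexes a basis of `V*`. -/
def IsBasis (α : Fin n → Dual ℝ V) (J : Finset (Fin n)) : Prop :=
  LinearIndependent ℝ (fun j : J => α j) ∧ IsGenerating α (J : Set (Fin n))

/-- `ε` is regular if it lies on no subspace of `V*` of dimension less than `dim V` that is spanned
by a subset of the `α_i`. -/
def IsRegular (α : Fin n → Dual ℝ V) (ε : Dual ℝ V) : Prop :=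
  ∀ J : Set (Fin n), finrank ℝ (spanOf α J) < finrank ℝ V → ε ∉ spanOf α J

/-- The complement in `V` of the union of the hyperplanes `α_i = 0`. -/
def hyperplaneComplement (α : Fin n → Dual ℝ V) : Set V :=
  (⋃ i, {v : V | α i v = 0})ᶜ

/-- `Λ` is a connected component of the complement of the hyperplanes `α_i = 0`. -/
def IsComponent [TopologicalSpace V] (α : Fin n → Dual ℝ V) (Λ : Set V) : Prop :=
  ∃ ξ ∈ hyperplaneComplement α, Λ = connectedComponentIn (hyperplaneComplement α) ξ

/-- `Λ^∨`: the linear functions that are positive on `Λ`. -/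
def dualCone (Λ : Set V) : Set (Dual ℝ V) :=
  {β | ∀ v ∈ Λ, 0 < β v}

/-- The multiplicative set generated by the `α_i` in `ℝ[V]`. -/
def denominators (α : Fin n → Dual ℝ V) : Submonoid (Poly V) :=
  Submonoid.closure (Set.range fun i => lin (α i))

/-- The algebra `R_α` of fractions `P / ∏ α_i ^ m_i`. -/
abbrev FractionAlgebra (α : Fin n → Dual ℝ V) : Type _ :=
  Localization (denominators α)

theorem prod_pow_mem_denominators (α : Fin n → Dual ℝ V) (m : Fin n → ℕ) :
    ∏ i, lin (α i) ^ m i ∈ denominators α :=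
  Submonoid.prod_mem _ fun i _ =>
    Submonoid.pow_mem _ (Submonoid.subset_closure (Set.mem_range_self i)) _

/-- The fraction `P / ∏ α_i ^ m_i`. -/
def frac (α : Fin n → Dual ℝ V) (P : Poly V) (m : Fin n → ℕ) : FractionAlgebra α :=
  Localization.mk P ⟨∏ i, lin (α i) ^ m i, prod_pow_mem_denominators α m⟩

/-- The homogeneous part of degree `-d` of `G_α`, where `G_α` is spanned by the fractions
`1 / ∏ α_i ^ m_i` such that `{i | m_i > 0}` is generating. -/
def generatingPart (α : Fin n → Dual ℝ V) (d : ℕ) : Submodule ℝ (FractionAlgebra α) :=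
  Submodule.span ℝ {x | ∃ m : Fin n → ℕ,
    IsGenerating α {i | 0 < m i} ∧ ∑ i, m i = d ∧ x = frac α 1 m}

/-- The space `NG_α` spanned by the fractions `P / ∏ α_i ^ m_i` such that `{i | m_i > 0}` is not
generating. -/
def nonGeneratingPart (α : Fin n → Dual ℝ V) : Submodule ℝ (FractionAlgebra α) :=
  Submodule.span ℝ {x | ∃ (P : Poly V) (m : Fin n → ℕ),
    ¬ IsGenerating α {i | 0 < m i} ∧ x = frac α P m}

/-- The fraction `1 / ∏_{j ∈ J} α_j`. -/
def basicFraction (α : Fin n → Dual ℝ V) (J : Finset (Fin n)) : FractionAlgebra α :=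
  frac α 1 fun i => if i ∈ J then 1 else 0

/-- The Gram determinant of the `α_j`, `j ∈ J`, for the bilinear form `B` on `V*`. -/
def gramDet (B : LinearMap.BilinForm ℝ (Dual ℝ V)) (α : Fin n → Dual ℝ V) (J : Finset (Fin n)) :
    ℝ :=
  (Matrix.of fun k l : J => B (α k) (α l)).det

/-- The defining properties of the linear functional `JK_ε`: it vanishes on `NG_α` and on the parts
of `G_α` of degree different from `-r`, where `r = dim V`, and it has the prescribed values on the
fractions `1 / ∏_{j ∈ J} α_j`, `J` a basis, which span the part of `G_α` of degree `-r`. -/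
structure IsJK (B : LinearMap.BilinForm ℝ (Dual ℝ V)) (α : Fin n → Dual ℝ V) (ε : Dual ℝ V)
    (f : FractionAlgebra α →ₗ[ℝ] ℝ) : Prop where
  vanish_nonGenerating : ∀ x ∈ nonGeneratingPart α, f x = 0
  vanish_generating : ∀ d : ℕ, d ≠ finrank ℝ V → ∀ x ∈ generatingPart α d, f x = 0
  apply_of_mem_cone : ∀ J : Finset (Fin n), IsBasis α J → ε ∈ cone α (J : Set (Fin n)) →
    f (basicFraction α J) = 1 / Real.sqrt (gramDet B α J)
  apply_of_notMem_cone : ∀ J : Finset (Fin n), IsBasis α J → ε ∉ cone α (J : Set (Fin n)) →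
    f (basicFraction α J) = 0

open Classical in
/-- The functional `JK_ε`: the linear functional with the properties `IsJK` (and `0` if there is no
such functional). -/
def jk (B : LinearMap.BilinForm ℝ (Dual ℝ V)) (α : Fin n → Dual ℝ V) (ε : Dual ℝ V) :
    FractionAlgebra α →ₗ[ℝ] ℝ :=
  if h : ∃ f : FractionAlgebra α →ₗ[ℝ] ℝ, IsJK B α ε f then h.choose else 0

/-- The ideal generated by the products `∏_{j ∈ J} α_j` with `ε ∉ Cone(α_i | i ∉ J)`. -/
def coneIdeal (α : Fin n → Dual ℝ V) (ε : Dual ℝ V) : Ideal (Poly V) :=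
  Ideal.span {p | ∃ J : Finset (Fin n),
    ε ∉ cone α ((J : Set (Fin n))ᶜ) ∧ p = ∏ j ∈ J, lin (α j)}

/-- `H` is a hyperplane of `V*` spanned by a subset of the `α_i`. -/
def IsSpannedHyperplane (α : Fin n → Dual ℝ V) (H : Submodule ℝ (Dual ℝ V)) : Prop :=
  finrank ℝ H + 1 = finrank ℝ V ∧ ∃ S : Set (Fin n), H = spanOf α S

/-- `U` is the open half-space of the hyperplane `H` that contains `ε`. -/
def IsOpenHalfSpace (H : Submodule ℝ (Dual ℝ V)) (ε : Dual ℝ V) (U : Set (Dual ℝ V)) : Prop :=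
  ∃ ℓ : Dual ℝ (Dual ℝ V), LinearMap.ker ℓ = H ∧ 0 < ℓ ε ∧ U = {β | 0 < ℓ β}

/-- The ideal generated by the products `∏_{α_i ∈ H⁺} α_i`, where `H` runs over the hyperplanes
spanned by subsets of the `α_i` and `H⁺` is the open half-space of `H` containing `ε`. -/
def halfSpaceIdeal (α : Fin n → Dual ℝ V) (ε : Dual ℝ V) : Ideal (Poly V) :=
  Ideal.span {p | ∃ (H : Submodule ℝ (Dual ℝ V)) (U : Set (Dual ℝ V)) (J : Finset (Fin n)),
    IsSpannedHyperplane α H ∧ IsOpenHalfSpace H ε U ∧ (∀ i, i ∈ J ↔ α i ∈ U) ∧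
      p = ∏ i ∈ J, lin (α i)}

end

end JeffreyKirwan

namespace JeffreyKirwan

noncomputable section

open Module

variable {V : Type*} [AddCommGroup V] [Module ℝ V] {n : ℕ}

/-! ### Coefficient vectors for spans and cones, and the effect of regularity. -/

section Representations

variable {α : Fin n → Dual ℝ V}

/-! Write r for the dimension of V. Both halves of the argument rest on the simplex method. Call a
basis J feasible if ε has positive coordinates in it. By regularity, ε never has a zero coordinate
in a basis whose cone contains it. If a vector α_i, i ∉ J, is added to a feasible basis J,
polarization makes some coordinate of α_i positive, and regularity makes the ratio test strict. So
exactly one element j ∈ J can be removed to give another feasible basis (`IsFeasible.exists_ratio`,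
`IsFeasible.pivot`, `IsFeasible.notMem_cone_of_ne`).

Existence of JK_ε. A functional f killing NG is determined by the numbers w(m) = f(1/∏ α_i^{m_i}),
since a linear factor in a numerator can be expanded in the α_i of a generating denominator and
cancelled. These numbers satisfy the relations defining `weights`. Conversely, every w in `weights`
comes from such a functional: multiplication by linear functions acts on weights by commuting
operators `shift`, hence so does ℝ[V] (`act`), and P/∏ α_i^{m_i} ↦ (P·w)(m) is well defined
(`exists_functional`). It remains to see that the prescribed values form a weight
(`jkWeight_mem_weights`). A nontrivial relation among r+1 of the α_i has no feasible term or exactly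
two, and these two cancel because the Gram determinant changes by the square of the pivot
coefficient.

Kernel. Generators of the ideal, and their multiples, are killed because cancelling them leaves a
denominator whose cone misses ε. For the converse, modulo the ideal every homogeneous polynomial of
degree n-r is a combination of products ∏_{i ∉ J} α_i with J feasible (`homogeneousPart_le`). A
pivot makes two such products proportional, and pivots that decrease a suitable linear objective
lead from any feasible basis to any other (`exists_prod_compl_sub_smul_mem`). So the quotient in
this degree is at most a line, and on a spanning product JK_ε equals the inverse square root of a
positive Gram determinant.

Half-spaces. By Farkas' lemma, ε ∉ Cone(α_i | i ∉ J) gives a separating functional. It can be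
rotated until its kernel is spanned by some of the α_i (`exists_isSpannedHyperplane`), and then the
half-space product divides ∏_{j ∈ J} α_j. -/

theorem mem_span_image_iff_exists_coeff {R M : Type*} [Semiring R] [AddCommMonoid M] [Module R M]
    {v : Fin n → M} {J : Set (Fin n)} {β : M} :
    β ∈ Submodule.span R (v '' J) ↔
      ∃ x : Fin n → R, (∀ i ∉ J, x i = 0) ∧ β = ∑ i, x i • v i := by
  classical
  have hJ : (J.toFinset : Set (Fin n)) = J := by simp
  rw [← hJ, Submodule.mem_span_image_finset_iff_exists_fun']
  constructor
  · rintro ⟨c, rfl⟩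
    refine ⟨fun i => if i ∈ J then c i else 0, fun i hi => ?_, ?_⟩
    · rw [hJ] at hi
      simp [hi]
    · rw [← Finset.sum_subset (Finset.subset_univ J.toFinset)]
      · exact Finset.sum_congr rfl fun i hi => by simp [Set.mem_toFinset.1 hi]
      · intro i _ hi
        rw [Set.mem_toFinset] at hi
        simp [hi]
  · rintro ⟨x, hx, rfl⟩
    refine ⟨x, Finset.sum_subset (Finset.subset_univ _) fun i _ hi => ?_⟩
    rw [hx i (by simpa using hi), zero_smul]

theorem mem_spanOf_iff {J : Set (Fin n)} {β : Dual ℝ V} :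
    β ∈ spanOf α J ↔ ∃ x : Fin n → ℝ, (∀ i ∉ J, x i = 0) ∧ β = ∑ i, x i • α i :=
  mem_span_image_iff_exists_coeff

theorem mem_cone_iff {J : Set (Fin n)} {β : Dual ℝ V} :
    β ∈ cone α J ↔
      ∃ x : Fin n → ℝ, (∀ i, 0 ≤ x i) ∧ (∀ i ∉ J, x i = 0) ∧ β = ∑ i, x i • α i := by
  refine mem_span_image_iff_exists_coeff.trans ⟨?_, ?_⟩
  · rintro ⟨x, hx, rfl⟩
    exact ⟨fun i => x i, fun i => (x i).2, fun i hi => by simp [hx i hi], rfl⟩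
  · rintro ⟨x, h0, hx, rfl⟩
    exact ⟨fun i => ⟨x i, h0 i⟩, fun i hi => Subtype.ext (hx i hi), rfl⟩

theorem cone_le_spanOf {J : Set (Fin n)} {β : Dual ℝ V} (h : β ∈ cone α J) : β ∈ spanOf α J := by
  obtain ⟨x, -, hx, hβ⟩ := mem_cone_iff.1 h
  exact mem_spanOf_iff.2 ⟨x, hx, hβ⟩

theorem cone_mono {J K : Set (Fin n)} (h : J ⊆ K) {β : Dual ℝ V} (hβ : β ∈ cone α J) :
    β ∈ cone α K :=
  Submodule.span_mono (Set.image_mono h) hβ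

theorem IsGenerating.mono {J K : Set (Fin n)} (hJ : IsGenerating α J) (h : J ⊆ K) :
    IsGenerating α K :=
  top_le_iff.1 (hJ.symm.trans_le (Submodule.span_mono (Set.image_mono h)))

theorem IsGenerating.exists_coeff {J : Set (Fin n)} (hJ : IsGenerating α J) (β : Dual ℝ V) :
    ∃ x : Fin n → ℝ, (∀ i ∉ J, x i = 0) ∧ β = ∑ i, x i • α i :=
  mem_spanOf_iff.1 (hJ.symm ▸ Submodule.mem_top)

theorem IsBasis.coeff_eq_zero {J : Finset (Fin n)} (hJ : IsBasis α J) {x : Fin n → ℝ}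
    (hx : ∀ i ∉ J, x i = 0) (h : ∑ i, x i • α i = 0) : x = 0 := by
  funext i
  by_cases hi : i ∈ J
  · refine Fintype.linearIndependent_iff.1 hJ.1 (fun j => x j) ?_ ⟨i, hi⟩
    rw [Finset.sum_coe_sort J fun j => x j • α j, ← h]
    exact Finset.sum_subset (Finset.subset_univ _) fun i _ hi => by rw [hx i hi, zero_smul]
  · exact hx i hi

theorem IsBasis.coeff_unique {J : Finset (Fin n)} (hJ : IsBasis α J) {x y : Fin n → ℝ}
    (hx : ∀ i ∉ J, x i = 0) (hy : ∀ i ∉ J, y i = 0)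
    (h : ∑ i, x i • α i = ∑ i, y i • α i) : x = y := by
  refine sub_eq_zero.1 (hJ.coeff_eq_zero (x := x - y) (fun i hi => ?_) ?_)
  · simp [hx i hi, hy i hi]
  · rw [← sub_eq_zero, ← Finset.sum_sub_distrib] at h
    rw [← h]
    exact Finset.sum_congr rfl fun i _ => sub_smul (x i) (y i) (α i)

theorem IsBasis.card_eq {J : Finset (Fin n)} (hJ : IsBasis α J) : J.card = finrank ℝ V := by
  have h := finrank_span_eq_card hJ.1
  have hr : Set.range (fun j : J => α j) = α '' (J : Set (Fin n)) := by
    rw [Set.image_eq_range]; rfl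
  have hg : Submodule.span ℝ (α '' (J : Set (Fin n))) = ⊤ := hJ.2
  rw [hr, hg, finrank_top, Subspace.dual_finrank_eq] at h
  simpa using h.symm

theorem IsGenerating.isBasis {J : Finset (Fin n)} (hJ : IsGenerating α (J : Set (Fin n)))
    (hc : J.card = finrank ℝ V) : IsBasis α J := by
  refine ⟨linearIndependent_of_top_le_span_of_card_eq_finrank ?_ ?_, hJ⟩
  · have hr : Set.range (fun j : J => α j) = α '' (J : Set (Fin n)) := by
      rw [Set.image_eq_range]; rfl
    rw [hr]
    exact hJ.symm.le
  · simp [hc, Subspace.dual_finrank_eq]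

theorem finrank_le_card_of_isGenerating {J : Finset (Fin n)}
    (hJ : IsGenerating α (J : Set (Fin n))) : finrank ℝ V ≤ J.card := by
  classical
  have h : finrank ℝ (Submodule.span ℝ ((J.image α : Finset (Dual ℝ V)) : Set (Dual ℝ V))) ≤ _ :=
    finrank_span_finset_le_card (J.image α)
  have hg : Submodule.span ℝ (α '' (J : Set (Fin n))) = ⊤ := hJ
  rw [Finset.coe_image, hg, finrank_top, Subspace.dual_finrank_eq] at h
  exact h.trans Finset.card_image_le

variable [FiniteDimensional ℝ V] {ε : Dual ℝ V}

theorem IsRegular.isGenerating (hε : IsRegular α ε) {J : Set (Fin n)} (h : ε ∈ spanOf α J) :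
    IsGenerating α J := by
  refine Submodule.eq_top_of_finrank_eq (le_antisymm (Submodule.finrank_le _) ?_)
  rw [Subspace.dual_finrank_eq]
  exact not_lt.1 fun hlt => hε J hlt h

theorem IsRegular.finrank_le_card (hε : IsRegular α ε) {J : Finset (Fin n)} {x : Fin n → ℝ}
    (hx : ∀ i ∉ J, x i = 0) (h : ε = ∑ i, x i • α i) : finrank ℝ V ≤ J.card :=
  finrank_le_card_of_isGenerating (hε.isGenerating (mem_spanOf_iff.2 ⟨x, by simpa using hx, h⟩))

end Representations

/-! ### Feasible bases and simplex pivots. -/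

section Exchange

/-- `J` is a basis such that `ε` lies in the interior of `Cone(α_j | j ∈ J)`, and the `x j` are the
coordinates of `ε`. -/
structure IsFeasible (α : Fin n → Dual ℝ V) (ε : Dual ℝ V) (J : Finset (Fin n))
    (x : Fin n → ℝ) : Prop where
  isBasis : IsBasis α J
  pos : ∀ j ∈ J, 0 < x j
  eq_zero : ∀ i ∉ J, x i = 0
  eq_sum : ε = ∑ i, x i • α i

variable {α : Fin n → Dual ℝ V} {ε : Dual ℝ V}

theorem IsFeasible.mem_cone {J : Finset (Fin n)} {x : Fin n → ℝ} (h : IsFeasible α ε J x) :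
    ε ∈ cone α (J : Set (Fin n)) := by
  refine mem_cone_iff.2 ⟨x, fun i => ?_, by simpa using h.eq_zero, h.eq_sum⟩
  by_cases hi : i ∈ J
  · exact (h.pos i hi).le
  · exact (h.eq_zero i hi).ge

/-- Uniqueness of the pivot. If ε had nonnegative coefficients y on (J \ k) ∪ {i}, comparing
coordinates in J would give x_k = y_i a_k and x_j = y_j + y_i a_j. Then a_k > 0 and x_j a_k ≥ x_k
a_j, against the strict ratio inequality. -/
theorem IsFeasible.notMem_cone_of_ne {J : Finset (Fin n)} {x : Fin n → ℝ}
    (hJ : IsFeasible α ε J x) {i : Fin n} (hi : i ∉ J)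
    {a : Fin n → ℝ} (ha : ∀ j ∉ J, a j = 0) (hai : α i = ∑ j, a j • α j) {j : Fin n} (hj : j ∈ J)
    (hmin : ∀ k ∈ J, k ≠ j → x j * a k < x k * a j) {k : Fin n} (hk : k ∈ J)
    (hkj : k ≠ j) : ε ∉ cone α ((insert i (J.erase k) : Finset (Fin n)) : Set (Fin n)) := by
  intro hmem
  obtain ⟨y, hy0, hy, hsum⟩ := mem_cone_iff.1 hmem
  have hx : x = y - Pi.single i (y i) + y i • a := by
    refine hJ.isBasis.coeff_unique hJ.eq_zero (fun l hl => ?_) ?_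
    · simp only [Pi.add_apply, Pi.sub_apply, Pi.smul_apply, smul_eq_mul, ha l hl, mul_zero,
        add_zero]
      by_cases hli : l = i
      · subst hli; simp
      · rw [Pi.single_eq_of_ne hli, sub_zero]
        exact hy l (by simp [hli, hl])
    · simp only [Pi.add_apply, Pi.sub_apply, Pi.smul_apply, smul_eq_mul, add_smul, sub_smul,
        Finset.sum_add_distrib, Finset.sum_sub_distrib, mul_smul, ← Finset.smul_sum, ← hai,
        ← hJ.eq_sum, ← hsum]
      rw [Finset.sum_eq_single i (fun b _ hb => by simp [hb]) (by simp)]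
      simp
  have hki : k ≠ i := fun h => hi (h ▸ hk)
  have hji : j ≠ i := fun h => hi (h ▸ hj)
  have hxk : x k = y i * a k := by
    have h1 := congrFun hx k
    have h2 : y k = 0 := hy k (by simp [hki])
    simpa [hki, h2] using h1
  have hxj : x j = y j + y i * a j := by
    have h1 := congrFun hx j
    simpa [hji] using h1
  have h1 := hmin k hk hkj
  have h2 := hJ.pos k hk
  have hak : 0 < a k := by
    by_contra hak
    have := mul_nonpos_of_nonneg_of_nonpos (hy0 i) (not_lt.1 hak)
    linarith
  rw [hxk, hxj] at h1
  have := mul_nonneg (hy0 j) hak.le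
  linarith

variable [FiniteDimensional ℝ V]

/-- A vanishing coordinate at an element of J would put ε in the span of r-1 of the α_i. -/
theorem IsRegular.isFeasible (hε : IsRegular α ε) {J : Finset (Fin n)}
    (hc : J.card = finrank ℝ V) {x : Fin n → ℝ} (h0 : ∀ i, 0 ≤ x i) (hx : ∀ i ∉ J, x i = 0)
    (h : ε = ∑ i, x i • α i) : IsFeasible α ε J x := by
  refine ⟨(hε.isGenerating (mem_spanOf_iff.2 ⟨x, by simpa using hx, h⟩)).isBasis hc,
    fun j hj => lt_of_le_of_ne (h0 j) fun hj0 => ?_, hx, h⟩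
  have := hε.finrank_le_card (J := J.erase j) (x := x) (fun i hi => ?_) h
  · have h1 := Finset.card_erase_lt_of_mem hj
    omega
  · by_cases hij : i = j
    · rw [hij, hj0]
    · exact hx i fun hiJ => hi (Finset.mem_erase.2 ⟨hij, hiJ⟩)

theorem IsRegular.exists_isFeasible (hε : IsRegular α ε) {J : Finset (Fin n)}
    (hc : J.card = finrank ℝ V) (h : ε ∈ cone α (J : Set (Fin n))) :
    ∃ x, IsFeasible α ε J x := by
  obtain ⟨x, h0, hx, h⟩ := mem_cone_iff.1 h
  exact ⟨x, hε.isFeasible hc h0 (by simpa using hx) h⟩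

/-- The ratio test of the simplex algorithm. -/
theorem IsFeasible.exists_ratio (hε : IsRegular α ε) {ξ : V} (hξ : ∀ i, 0 < α i ξ)
    {J : Finset (Fin n)} {x : Fin n → ℝ} (hJ : IsFeasible α ε J x) {i : Fin n}
    {a : Fin n → ℝ} (ha : ∀ j ∉ J, a j = 0) (hai : α i = ∑ j, a j • α j) :
    ∃ j ∈ J, 0 < a j ∧ ∀ k ∈ J, k ≠ j → x j * a k < x k * a j := by
  classical
  -- Polarization enters here: α_i is positive at ξ, so its coordinates cannot all be nonpositive.
  have hne : (J.filter fun j => 0 < a j).Nonempty := by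
    by_contra hempty
    rw [Finset.not_nonempty_iff_eq_empty, Finset.filter_eq_empty_iff] at hempty
    have h1 : α i ξ ≤ 0 := by
      rw [hai, LinearMap.sum_apply]
      refine Finset.sum_nonpos fun j _ => ?_
      rw [LinearMap.smul_apply, smul_eq_mul]
      refine mul_nonpos_of_nonpos_of_nonneg ?_ (hξ j).le
      by_cases hj : j ∈ J
      · exact not_lt.1 (hempty hj)
      · exact (ha j hj).le
    exact absurd (hξ i) (not_lt.2 h1)
  obtain ⟨j, hj, hmin⟩ := Finset.exists_min_image _ (fun j => x j / a j) hne
  obtain ⟨hjJ, haj⟩ := Finset.mem_filter.1 hj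
  refine ⟨j, hjJ, haj, fun k hk hkj => ?_⟩
  rcases le_or_gt (a k) 0 with hak | hak
  · exact (mul_nonpos_of_nonneg_of_nonpos (hJ.pos j hjJ).le hak).trans_lt
      (mul_pos (hJ.pos k hk) haj)
  · have hle := hmin k (Finset.mem_filter.2 ⟨hk, hak⟩)
    rw [div_le_div_iff₀ haj hak] at hle
    refine lt_of_le_of_ne hle fun heq => ?_
    -- A tie in the ratio test would make the coordinates at j and k vanish together after the
    -- pivot, leaving ε in the span of r-1 vectors.
    have hlt := hε.finrank_le_card (J := insert i ((J.erase j).erase k))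
      (x := x - (x j / a j) • a + Pi.single i (x j / a j)) (fun l hl => ?_) ?_
    · have h1 := Finset.card_insert_le i ((J.erase j).erase k)
      have h2 := Finset.card_erase_lt_of_mem (Finset.mem_erase.2 ⟨hkj, hk⟩)
      have h3 := Finset.card_erase_lt_of_mem hjJ
      have h4 := hJ.isBasis.card_eq
      omega
    · simp only [Finset.mem_insert, Finset.mem_erase, not_or, not_and] at hl
      simp only [Pi.add_apply, Pi.sub_apply, Pi.smul_apply, smul_eq_mul,
        Pi.single_eq_of_ne hl.1, add_zero]
      by_cases hlk : l = k
      · subst hlk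
        field_simp
        linarith
      by_cases hlj : l = j
      · subst hlj
        field_simp
        ring
      · have := hl.2 hlk hlj
        simp [hJ.eq_zero l this, ha l this]
    · simp only [Pi.add_apply, Pi.sub_apply, Pi.smul_apply, smul_eq_mul, add_smul, sub_smul,
        Finset.sum_add_distrib, Finset.sum_sub_distrib, mul_smul, ← Finset.smul_sum, ← hai,
        ← hJ.eq_sum]
      rw [Finset.sum_eq_single i (fun b _ hb => by simp [hb]) (by simp)]
      simp

/-- The pivot step of the simplex algorithm. -/
theorem IsFeasible.pivot (hε : IsRegular α ε)
    {J : Finset (Fin n)} {x : Fin n → ℝ} (hJ : IsFeasible α ε J x) {i : Fin n} (hi : i ∉ J)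
    {a : Fin n → ℝ} (ha : ∀ j ∉ J, a j = 0) (hai : α i = ∑ j, a j • α j) {j : Fin n} (hj : j ∈ J)
    (haj : 0 < a j) (hmin : ∀ k ∈ J, k ≠ j → x j * a k < x k * a j) :
    IsFeasible α ε (insert i (J.erase j)) (x - (x j / a j) • a + Pi.single i (x j / a j)) := by
  have hij : i ≠ j := fun h => hi (h ▸ hj)
  have ht : 0 < x j / a j := div_pos (hJ.pos j hj) haj
  refine hε.isFeasible ?_ (fun k => ?_) (fun k hk => ?_) ?_
  · rw [Finset.card_insert_of_notMem (fun h => hi (Finset.mem_of_mem_erase h)),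
      Finset.card_erase_add_one hj, hJ.isBasis.card_eq]
  · simp only [Pi.add_apply, Pi.sub_apply, Pi.smul_apply, smul_eq_mul]
    by_cases hki : k = i
    · subst hki
      simp [hJ.eq_zero k hi, ha k hi, ht.le]
    · rw [Pi.single_eq_of_ne hki, add_zero]
      by_cases hkJ : k ∈ J
      · by_cases hkj : k = j
        · subst hkj
          rw [div_mul_cancel₀ _ haj.ne', sub_self]
        · have := hmin k hkJ hkj
          rw [div_mul_eq_mul_div, sub_nonneg, div_le_iff₀ haj]
          exact this.le
      · simp [hJ.eq_zero k hkJ, ha k hkJ]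
  · simp only [Finset.mem_insert, Finset.mem_erase, not_or, not_and] at hk
    simp only [Pi.add_apply, Pi.sub_apply, Pi.smul_apply, smul_eq_mul,
      Pi.single_eq_of_ne hk.1, add_zero]
    by_cases hkj : k = j
    · subst hkj
      rw [div_mul_cancel₀ _ haj.ne', sub_self]
    · simp [hJ.eq_zero k (hk.2 hkj), ha k (hk.2 hkj)]
  · simp only [Pi.add_apply, Pi.sub_apply, Pi.smul_apply, smul_eq_mul, add_smul, sub_smul,
      Finset.sum_add_distrib, Finset.sum_sub_distrib, mul_smul, ← Finset.smul_sum, ← hai,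
      ← hJ.eq_sum]
    rw [Finset.sum_eq_single i (fun b _ hb => by simp [hb]) (by simp)]
    simp

end Exchange

/-! ### Gram determinants under exchange of a basis vector. -/

section Gram

variable {α : Fin n → Dual ℝ V} {B : LinearMap.BilinForm ℝ (Dual ℝ V)}

theorem gramDet_pos (hBsymm : B.IsSymm) (hBpos : ∀ β : Dual ℝ V, β ≠ 0 → 0 < B β β)
    {J : Finset (Fin n)} (hJ : LinearIndependent ℝ (fun j : J => α j)) : 0 < gramDet B α J := by
  refine Matrix.PosDef.det_pos (Matrix.PosDef.of_dotProduct_mulVec_pos ?_ fun x hx => ?_)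
  · ext k l
    simp [hBsymm.eq (α k) (α l)]
  · have hne : ∑ k, x k • α k ≠ 0 := fun h0 =>
      hx (funext fun k => Fintype.linearIndependent_iff.1 hJ x h0 k)
    refine (hBpos _ hne).trans_eq ?_
    simp only [dotProduct, Matrix.mulVec, Matrix.of_apply, map_sum, map_smul, LinearMap.sum_apply,
      LinearMap.smul_apply, smul_eq_mul, Finset.mul_sum, Pi.star_apply, star_trivial]
    rw [Finset.sum_comm]
    exact Finset.sum_congr rfl fun k _ => Finset.sum_congr rfl fun l _ => by ring

/-- The change-of-basis matrix is the identity with the column of j replaced by a. Its determinant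
is a_j, and the Gram determinant scales by the square. -/
theorem gramDet_exchange {J : Finset (Fin n)} {i j : Fin n} (hi : i ∉ J) (hj : j ∈ J)
    {a : Fin n → ℝ} (ha : ∀ k ∉ J, a k = 0) (hai : α i = ∑ k, a k • α k) :
    gramDet B α (insert i (J.erase j)) = a j ^ 2 * gramDet B α J := by
  classical
  let σ : J → (insert i (J.erase j) : Finset (Fin n)) := fun k =>
    if h : (k : Fin n) = j then ⟨i, Finset.mem_insert_self _ _⟩
    else ⟨k, Finset.mem_insert_of_mem (Finset.mem_erase.2 ⟨h, k.2⟩)⟩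
  have hσ : Function.Bijective σ := by
    rw [Fintype.bijective_iff_injective_and_card]
    refine ⟨fun k l hkl => ?_, ?_⟩
    · have hk : (k : Fin n) ≠ i := fun h => hi (h ▸ k.2)
      have hl : (l : Fin n) ≠ i := fun h => hi (h ▸ l.2)
      simp only [σ] at hkl
      apply Subtype.ext
      split_ifs at hkl with h1 h2 h2
      · rw [h1, h2]
      · exact absurd (congrArg Subtype.val hkl).symm hl
      · exact absurd (congrArg Subtype.val hkl) hk
      · simpa using hkl
    · rw [Fintype.card_coe, Fintype.card_coe,
        Finset.card_insert_of_notMem (fun h => hi (Finset.mem_of_mem_erase h)),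
        Finset.card_erase_add_one hj]
  let e := Equiv.ofBijective σ hσ
  let A : Matrix J J ℝ := (1 : Matrix J J ℝ).updateCol ⟨j, hj⟩ fun k => a k
  have hA : A.det = a j := by
    simp [A, ← Matrix.cramer_apply]
  have hsum : ∀ l, α (σ l) = ∑ k : J, A k l • α k := by
    intro l
    by_cases hl : l = ⟨j, hj⟩
    · subst hl
      simp only [σ, A, dite_true, Matrix.updateCol_self]
      rw [hai, Finset.sum_coe_sort J fun k => a k • α k]
      exact (Finset.sum_subset (Finset.subset_univ _) fun k _ hk => by
        rw [ha k hk, zero_smul]).symm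
    · have hl' : (l : Fin n) ≠ j := fun h => hl (Subtype.ext h)
      simp [σ, A, hl, hl', Matrix.updateCol_ne, Matrix.one_apply, ite_smul]
  unfold gramDet
  rw [← Matrix.det_submatrix_equiv_self e]
  have : (Matrix.of fun k l : (insert i (J.erase j) : Finset (Fin n)) => B (α k) (α l)).submatrix
      e e = A.transpose * (Matrix.of fun k l : J => B (α k) (α l)) * A := by
    ext k l
    simp only [Matrix.submatrix_apply, Matrix.of_apply, Matrix.mul_apply, Matrix.transpose_apply,
      e, Equiv.ofBijective_apply]
    rw [hsum k, hsum l]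
    simp only [map_sum, map_smul, LinearMap.sum_apply, LinearMap.smul_apply, smul_eq_mul,
      Finset.sum_mul, Finset.mul_sum]
    exact Finset.sum_congr rfl fun _ _ => Finset.sum_congr rfl fun _ _ => by ring
  rw [this, Matrix.det_mul, Matrix.det_mul, Matrix.det_transpose, hA]
  ring

end Gram

/-! ### Weights on exponents and the action of polynomials on them. -/

section Weights

variable (α : Fin n → Dual ℝ V)

/-- The families `w` of real numbers indexed by exponents `m` that satisfy the linear relations
between the fractions `1 / ∏ α_i ^ m_i` modulo `NG_α`. -/
def weights : Submodule ℝ ((Fin n → ℕ) → ℝ) where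
  carrier := {w | (∀ m, ¬ IsGenerating α {i | 0 < m i} → w m = 0) ∧
    ∀ (m : Fin n → ℕ) (c : Fin n → ℝ), (∀ i, ¬ 0 < m i → c i = 0) → ∑ i, c i • α i = 0 →
      ∑ i, c i * w (m - Pi.single i 1) = 0}
  add_mem' := by
    rintro v w ⟨hv, hv'⟩ ⟨hw, hw'⟩
    refine ⟨fun m hm => by simp [hv m hm, hw m hm], fun m c hc h => ?_⟩
    simp [mul_add, Finset.sum_add_distrib, hv' m c hc h, hw' m c hc h]
  zero_mem' := by simp
  smul_mem' := by
    rintro t w ⟨hw, hw'⟩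
    refine ⟨fun m hm => by simp [hw m hm], fun m c hc h => ?_⟩
    simp only [Pi.smul_apply, smul_eq_mul, mul_left_comm _ t, ← Finset.mul_sum, hw' m c hc h,
      mul_zero]

open Classical in
/-- Multiplication of fractions by a linear function, on the level of weights. -/
def shift (β : Dual ℝ V) (w : (Fin n → ℕ) → ℝ) (m : Fin n → ℕ) : ℝ :=
  if h : IsGenerating α {i | 0 < m i} then
    ∑ i, (h.exists_coeff β).choose i * w (m - Pi.single i 1)
  else 0

variable {α}

theorem sum_sub_smul (x y : Fin n → ℝ) :
    ∑ i, (x i - y i) • α i = ∑ i, x i • α i - ∑ i, y i • α i := by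
  rw [← Finset.sum_sub_distrib]
  exact Finset.sum_congr rfl fun i _ => sub_smul (x i) (y i) (α i)

theorem not_isGenerating_sub {m : Fin n → ℕ} (h : ¬ IsGenerating α {i | 0 < m i})
    (k : Fin n → ℕ) : ¬ IsGenerating α {i | 0 < (m - k) i} := fun h' =>
  h (h'.mono fun i (hi : 0 < m i - k i) => show 0 < m i by omega)

theorem shift_of_not_isGenerating {m : Fin n → ℕ} (h : ¬ IsGenerating α {i | 0 < m i})
    (β : Dual ℝ V) (w : (Fin n → ℕ) → ℝ) : shift α β w m = 0 :=
  dif_neg h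

/-- Two expansions of β over the support of m differ by a linear relation, which a weight kills. So
the coefficients chosen in `shift` do not matter. -/
theorem shift_eq_sum {w : (Fin n → ℕ) → ℝ} (hw : w ∈ weights α) {m : Fin n → ℕ} {x : Fin n → ℝ}
    (hx : ∀ i, ¬ 0 < m i → x i = 0) {β : Dual ℝ V} (hβ : β = ∑ i, x i • α i) :
    shift α β w m = ∑ i, x i * w (m - Pi.single i 1) := by
  by_cases h : IsGenerating α {i | 0 < m i}
  · rw [shift, dif_pos h]
    obtain ⟨h1, h2⟩ := (h.exists_coeff β).choose_spec
    set y := (h.exists_coeff β).choose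
    rw [← sub_eq_zero, ← Finset.sum_sub_distrib]
    simp only [← sub_mul]
    refine hw.2 m (fun i => y i - x i) (fun i hi => ?_) ?_
    · rw [h1 i hi, hx i hi, sub_zero]
    · rw [sum_sub_smul, ← h2, ← hβ, sub_self]
  · rw [shift_of_not_isGenerating h]
    refine (Finset.sum_eq_zero fun i _ => ?_).symm
    rw [hw.1 _ (not_isGenerating_sub h _), mul_zero]

theorem shift_add_left {w : (Fin n → ℕ) → ℝ} (hw : w ∈ weights α) (β γ : Dual ℝ V) :
    shift α (β + γ) w = shift α β w + shift α γ w := by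
  funext m
  by_cases h : IsGenerating α {i | 0 < m i}
  · obtain ⟨x, hx, hβ⟩ := h.exists_coeff β
    obtain ⟨y, hy, hγ⟩ := h.exists_coeff γ
    rw [Pi.add_apply, shift_eq_sum hw hx hβ, shift_eq_sum hw hy hγ,
      shift_eq_sum hw (x := x + y) (fun i hi => by simp [hx i hi, hy i hi]),
      ← Finset.sum_add_distrib]
    · simp only [Pi.add_apply, add_mul]
    · simp only [Pi.add_apply, add_smul, Finset.sum_add_distrib, ← hβ, ← hγ]
  · simp [shift_of_not_isGenerating h]

theorem shift_smul_left {w : (Fin n → ℕ) → ℝ} (hw : w ∈ weights α) (t : ℝ) (β : Dual ℝ V) :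
    shift α (t • β) w = t • shift α β w := by
  funext m
  by_cases h : IsGenerating α {i | 0 < m i}
  · obtain ⟨x, hx, hβ⟩ := h.exists_coeff β
    rw [Pi.smul_apply, shift_eq_sum hw hx hβ,
      shift_eq_sum hw (x := t • x) (fun i hi => by simp [hx i hi]), Finset.smul_sum]
    · simp only [Pi.smul_apply, smul_eq_mul, mul_assoc]
    · simp only [Pi.smul_apply, smul_eq_mul, mul_smul, ← Finset.smul_sum, ← hβ]
  · simp [shift_of_not_isGenerating h]

theorem shift_add_right (β : Dual ℝ V) (v w : (Fin n → ℕ) → ℝ) :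
    shift α β (v + w) = shift α β v + shift α β w := by
  funext m
  by_cases h : IsGenerating α {i | 0 < m i}
  · simp [shift, h, mul_add, Finset.sum_add_distrib]
  · simp [shift_of_not_isGenerating h]

theorem shift_smul_right (β : Dual ℝ V) (t : ℝ) (w : (Fin n → ℕ) → ℝ) :
    shift α β (t • w) = t • shift α β w := by
  funext m
  by_cases h : IsGenerating α {i | 0 < m i}
  · simp [shift, h, Finset.mul_sum, mul_left_comm]
  · simp [shift_of_not_isGenerating h]

theorem shift_sum {w : (Fin n → ℕ) → ℝ} (hw : w ∈ weights α) (x : Fin n → ℝ) (m : Fin n → ℕ) :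
    shift α (∑ i, x i • α i) w m = ∑ i, x i * shift α (α i) w m := by
  let f : Dual ℝ V →ₗ[ℝ] ℝ :=
    { toFun := fun β => shift α β w m
      map_add' := fun β γ => by rw [shift_add_left hw, Pi.add_apply]
      map_smul' := fun t β => by rw [shift_smul_left hw, Pi.smul_apply, RingHom.id_apply] }
  exact (map_sum f (fun i => x i • α i) Finset.univ).trans
    (Finset.sum_congr rfl fun i _ => map_smul f (x i) (α i))

theorem shift_apply_self {w : (Fin n → ℕ) → ℝ} (hw : w ∈ weights α) {m : Fin n → ℕ} {j : Fin n}
    (hj : 0 < m j) : shift α (α j) w m = w (m - Pi.single j 1) := by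
  rw [shift_eq_sum hw (x := Pi.single j 1) (fun i hi => ?_)]
  · rw [Finset.sum_eq_single j (fun i _ hi => by simp [hi]) (by simp)]
    simp
  · rw [Finset.sum_eq_single j (fun i _ hi => by simp [hi]) (by simp)]
    simp
  · exact Pi.single_eq_of_ne (by rintro rfl; exact hi hj) _

theorem shift_apply_self_add {w : (Fin n → ℕ) → ℝ} (hw : w ∈ weights α) (m : Fin n → ℕ)
    (j : Fin n) : shift α (α j) w (m + Pi.single j 1) = w m := by
  rw [shift_apply_self hw (by simp)]
  congr 1
  funext i
  simp

theorem sub_single_pos {m : Fin n → ℕ} {i j : Fin n} (hij : i ≠ j) (hj : 0 < m j) :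
    0 < (m - Pi.single i 1 : Fin n → ℕ) j := by
  simpa [Pi.single_eq_of_ne hij.symm] using hj

/-- By linearity in β it suffices to treat β = α_j with m_j > 0. The relation c at m then reduces to
relations satisfied by w, except that removing j may delete it from the support. -/
theorem shift_mem {w : (Fin n → ℕ) → ℝ} (hw : w ∈ weights α) (β : Dual ℝ V) :
    shift α β w ∈ weights α := by
  refine ⟨fun m hm => shift_of_not_isGenerating hm β w, fun m c hc hsum => ?_⟩
  by_cases h : IsGenerating α {i | 0 < m i}
  swap
  · exact Finset.sum_eq_zero fun i _ => by
      rw [shift_of_not_isGenerating (not_isGenerating_sub h _), mul_zero]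
  obtain ⟨x, hx, rfl⟩ := h.exists_coeff β
  simp only [shift_sum hw, Finset.mul_sum]
  rw [Finset.sum_comm]
  refine Finset.sum_eq_zero fun j _ => ?_
  simp only [mul_left_comm _ (x j), ← Finset.mul_sum]
  by_cases hj : 0 < m j
  swap
  · rw [hx j hj, zero_mul]
  refine mul_eq_zero_of_right _ ?_
  -- If m_j = 1, the term i = j cannot cancel α_j directly. The relation itself rewrites c_j α_j as
  -- -∑_{i ≠ j} c_i α_i, which lives on the remaining support and cancels the other terms. If m_j ≥
  -- 2, every term cancels α_j and the relation at m - e_j applies.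
  by_cases hj1 : m j = 1
  · have hmj : ¬ 0 < (m - Pi.single j 1 : Fin n → ℕ) j := by simp [hj1]
    have hrel : c j • α j = ∑ i, (Pi.single j (c j) - c : Fin n → ℝ) i • α i := by
      simp only [Pi.sub_apply, sum_sub_smul, hsum, sub_zero]
      rw [Finset.sum_eq_single j (fun i _ hi => by simp [hi]) (by simp)]
      simp
    have h1 : c j * shift α (α j) w (m - Pi.single j 1) =
        ∑ i, (Pi.single j (c j) - c : Fin n → ℝ) i * w (m - Pi.single j 1 - Pi.single i 1) := by
      rw [← shift_eq_sum hw (fun i hi => ?_) hrel, shift_smul_left hw, Pi.smul_apply, smul_eq_mul]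
      by_cases hij : i = j
      · subst hij; simp
      · have : ¬ 0 < m i := fun h => hi (sub_single_pos (Ne.symm hij) h)
        simp [hij, hc i this]
    rw [← Finset.add_sum_erase _ _ (Finset.mem_univ j), h1,
      ← Finset.add_sum_erase _ _ (Finset.mem_univ j), Pi.sub_apply, Pi.single_eq_same, sub_self,
      zero_mul, zero_add, ← Finset.sum_add_distrib]
    refine Finset.sum_eq_zero fun i hi => ?_
    have hij : i ≠ j := Finset.ne_of_mem_erase hi
    rw [shift_apply_self hw (sub_single_pos hij hj), Pi.sub_apply, Pi.single_eq_of_ne hij,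
      tsub_right_comm]
    ring
  · have h2 : 0 < (m - Pi.single j 1 : Fin n → ℕ) j := by
      simp only [Pi.sub_apply, Pi.single_eq_same]
      omega
    refine Eq.trans (Finset.sum_congr rfl fun i _ => ?_)
      (hw.2 (m - Pi.single j 1) c (fun i hi => hc i fun h => hi ?_) hsum)
    · have h3 : 0 < (m - Pi.single i 1 : Fin n → ℕ) j := by
        by_cases hij : i = j
        · rwa [hij]
        · exact sub_single_pos hij hj
      rw [shift_apply_self hw h3, tsub_right_comm]
    · by_cases hij : j = i
      · rwa [← hij]
      · exact sub_single_pos hij h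

theorem shift_comm {w : (Fin n → ℕ) → ℝ} (hw : w ∈ weights α) (β γ : Dual ℝ V) :
    shift α β (shift α γ w) = shift α γ (shift α β w) := by
  funext m
  by_cases h : IsGenerating α {i | 0 < m i}
  swap
  · rw [shift_of_not_isGenerating h, shift_of_not_isGenerating h]
  obtain ⟨x, hx, hβ⟩ := h.exists_coeff β
  obtain ⟨y, hy, hγ⟩ := h.exists_coeff γ
  rw [shift_eq_sum (shift_mem hw γ) hx hβ, shift_eq_sum (shift_mem hw β) hy hγ, hβ, hγ]
  simp only [shift_sum hw, Finset.mul_sum]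
  rw [Finset.sum_comm]
  refine Finset.sum_congr rfl fun j _ => Finset.sum_congr rfl fun i _ => ?_
  by_cases hi : 0 < m i
  swap
  · simp [hx i hi]
  by_cases hj : 0 < m j
  swap
  · simp [hy j hj]
  by_cases hij : i = j
  · subst hij
    ring
  · rw [shift_apply_self hw (sub_single_pos hij hj),
      shift_apply_self hw (sub_single_pos (Ne.symm hij) hi), tsub_right_comm]
    ring

variable (α)

/-- `shift` as a linear map to the endomorphisms of `weights α`. -/
def shiftEnd : Dual ℝ V →ₗ[ℝ] Module.End ℝ (weights α) where
  toFun β :=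
    { toFun := fun w => ⟨shift α β w, shift_mem w.2 β⟩
      map_add' := fun v w => Subtype.ext (shift_add_right β v.1 w.1)
      map_smul' := fun t w => Subtype.ext (shift_smul_right β t w.1) }
  map_add' β γ := LinearMap.ext fun w : weights α => Subtype.ext (shift_add_left w.2 β γ)
  map_smul' t β := LinearMap.ext fun w : weights α => Subtype.ext (shift_smul_left w.2 t β)

-- The universal property of the symmetric algebra needs a commutative target. The subalgebra
-- generated by the commuting image is one.
open scoped IsMulCommutative in
theorem exists_algHom_of_commute {M A : Type*} [AddCommGroup M] [Module ℝ M] [Ring A] [Algebra ℝ A]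
    (f : M →ₗ[ℝ] A) (hf : ∀ x y, f x * f y = f y * f x) :
    ∃ F : SymmetricAlgebra ℝ M →ₐ[ℝ] A, ∀ x, F (SymmetricAlgebra.ι ℝ M x) = f x := by
  have hcomm : ∀ a ∈ Set.range f, ∀ b ∈ Set.range f, a * b = b * a := by
    rintro _ ⟨x, rfl⟩ _ ⟨y, rfl⟩
    exact hf x y
  have := Algebra.isMulCommutative_adjoin ℝ hcomm
  let g : M →ₗ[ℝ] Algebra.adjoin ℝ (Set.range f) :=
    f.codRestrict (Subalgebra.toSubmodule (Algebra.adjoin ℝ (Set.range f)))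
      fun x => Algebra.subset_adjoin (Set.mem_range_self x)
  refine ⟨(Algebra.adjoin ℝ (Set.range f)).val.comp (SymmetricAlgebra.lift g), fun x => ?_⟩
  rw [AlgHom.comp_apply, SymmetricAlgebra.lift_ι_apply]
  rfl

theorem shiftEnd_commute (β γ : Dual ℝ V) :
    shiftEnd α β * shiftEnd α γ = shiftEnd α γ * shiftEnd α β :=
  LinearMap.ext fun w : weights α => Subtype.ext (shift_comm w.2 β γ)

theorem exists_act : ∃ F : Poly V →ₐ[ℝ] Module.End ℝ (weights α),
    ∀ β, F (lin β) = shiftEnd α β :=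
  exists_algHom_of_commute (A := Module.End ℝ (weights α)) (shiftEnd α) (shiftEnd_commute α)

/-- The action of polynomials on weights. -/
def act : Poly V →ₐ[ℝ] Module.End ℝ (weights α) :=
  (exists_act α).choose

theorem act_lin (β : Dual ℝ V) : act α (lin β) = shiftEnd α β :=
  (exists_act α).choose_spec β

variable {α}

theorem act_lin_mul_apply (P : Poly V) (β : Dual ℝ V) (w : weights α) :
    (act α (lin β * P) w : (Fin n → ℕ) → ℝ) = shift α β (act α P w) := by
  rw [map_mul, act_lin]
  rfl

theorem act_lin_mul_apply_add (P : Poly V) (w : weights α) (m : Fin n → ℕ) (i : Fin n) :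
    (act α (lin (α i) * P) w).1 (m + Pi.single i 1) = (act α P w).1 m := by
  rw [act_lin_mul_apply, shift_apply_self_add (act α P w).2]

theorem exists_eq_of_mem_denominators {s : Poly V} (hs : s ∈ denominators α) :
    ∃ m : Fin n → ℕ, s = ∏ i, lin (α i) ^ m i := by
  induction hs using Submonoid.closure_induction with
  | mem s hs =>
    obtain ⟨i, rfl⟩ := hs
    refine ⟨Pi.single i 1, ?_⟩
    rw [Finset.prod_eq_single i (fun j _ hj => by simp [hj]) (by simp)]
    simp
  | one => exact ⟨0, by simp⟩
  | mul s t _ _ hs ht =>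
    obtain ⟨k, rfl⟩ := hs
    obtain ⟨l, rfl⟩ := ht
    exact ⟨k + l, by simp [pow_add, Finset.prod_mul_distrib]⟩

theorem prod_pow_add_single (m : Fin n → ℕ) (i : Fin n) :
    ∏ j, lin (α j) ^ (m + Pi.single i 1 : Fin n → ℕ) j = lin (α i) * ∏ j, lin (α j) ^ m j := by
  simp only [Pi.add_apply, pow_add, Finset.prod_mul_distrib]
  rw [mul_comm, Finset.prod_eq_single (f := fun j => lin (α j) ^ (Pi.single i 1 : Fin n → ℕ) j) i
    (fun j _ hj => by simp [hj]) (by simp)]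
  simp

theorem exponent_induction {motive : (Fin n → ℕ) → Prop} (zero : motive 0)
    (add_single : ∀ k i, motive k → motive (k + Pi.single i 1)) (k : Fin n → ℕ) : motive k := by
  obtain ⟨N, hN⟩ : ∃ N, ∑ i, k i = N := ⟨_, rfl⟩
  induction N generalizing k with
  | zero =>
    have : k = 0 := funext fun i => Finset.sum_eq_zero_iff.1 hN i (Finset.mem_univ i)
    exact this ▸ zero
  | succ N ih =>
    obtain ⟨i, -, hi⟩ := Finset.exists_ne_zero_of_sum_ne_zero (hN.trans_ne N.succ_ne_zero)
    have hk : k = (k - Pi.single i 1) + Pi.single i 1 := by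
      funext j
      by_cases hj : j = i
      · subst hj
        simp only [Pi.add_apply, Pi.sub_apply, Pi.single_eq_same]
        omega
      · simp [hj]
    rw [hk]
    refine add_single _ i (ih _ ?_)
    have h1 : ∑ j, (k - Pi.single i 1 + Pi.single i 1 : Fin n → ℕ) j = N + 1 := hk ▸ hN
    simpa [Finset.sum_add_distrib] using h1

theorem act_prod_mul_apply_add (P : Poly V) (w : weights α) (m k : Fin n → ℕ) :
    (act α ((∏ i, lin (α i) ^ k i) * P) w).1 (m + k) = (act α P w).1 m := by
  induction k using exponent_induction with
  | zero => simp
  | add_single k i ih =>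
    rw [prod_pow_add_single, mul_assoc, ← add_assoc, act_lin_mul_apply_add, ih]

end Weights

/-! ### Weights as functionals on fractions modulo NG. -/

section Fractions

variable {α : Fin n → Dual ℝ V}

theorem exists_eq_frac (x : FractionAlgebra α) : ∃ P m, x = frac α P m := by
  induction x using Localization.induction_on with
  | H y =>
    obtain ⟨P, s, hs⟩ := y
    obtain ⟨m, rfl⟩ := exists_eq_of_mem_denominators hs
    exact ⟨P, m, rfl⟩

theorem frac_eq_frac_iff {P Q : Poly V} {k l : Fin n → ℕ} :
    frac α P k = frac α Q l ↔ ∃ m : Fin n → ℕ,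
      (∏ i, lin (α i) ^ m i) * ((∏ i, lin (α i) ^ l i) * P) =
        (∏ i, lin (α i) ^ m i) * ((∏ i, lin (α i) ^ k i) * Q) := by
  rw [frac, frac, Localization.mk_eq_mk_iff, Localization.r_iff_exists]
  constructor
  · rintro ⟨⟨c, hc⟩, h⟩
    obtain ⟨m, rfl⟩ := exists_eq_of_mem_denominators hc
    exact ⟨m, h⟩
  · rintro ⟨m, h⟩
    exact ⟨⟨_, prod_pow_mem_denominators α m⟩, h⟩

theorem frac_add_frac (P Q : Poly V) (k l : Fin n → ℕ) :
    frac α P k + frac α Q l =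
      frac α ((∏ i, lin (α i) ^ k i) * Q + (∏ i, lin (α i) ^ l i) * P) (k + l) := by
  rw [frac, frac, frac, Localization.add_mk]
  congr 1
  exact Subtype.ext (by simp [pow_add, Finset.prod_mul_distrib])

theorem frac_add (P Q : Poly V) (m : Fin n → ℕ) :
    frac α (P + Q) m = frac α P m + frac α Q m :=
  (Localization.add_mk_self P _ Q).symm

theorem frac_smul (t : ℝ) (P : Poly V) (m : Fin n → ℕ) :
    frac α (t • P) m = t • frac α P m :=
  (Localization.smul_mk t P _).symm

variable (α) in
/-- The fractions with a given denominator, as a linear function of the numerator. -/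
def fracLinearMap (m : Fin n → ℕ) : Poly V →ₗ[ℝ] FractionAlgebra α where
  toFun P := frac α P m
  map_add' P Q := frac_add P Q m
  map_smul' t P := frac_smul t P m

theorem frac_lin_mul {m : Fin n → ℕ} {i : Fin n} (hi : 0 < m i) (P : Poly V) :
    frac α (lin (α i) * P) m = frac α P (m - Pi.single i 1) := by
  have hm : m = m - Pi.single i 1 + Pi.single i 1 := by
    funext j
    by_cases hj : j = i
    · subst hj
      simp only [Pi.add_apply, Pi.sub_apply, Pi.single_eq_same]
      omega
    · simp [hj]
  rw [frac_eq_frac_iff]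
  refine ⟨0, ?_⟩
  conv_rhs => rw [hm, prod_pow_add_single]
  simp only [Pi.zero_apply, pow_zero, Finset.prod_const_one, one_mul]
  ring

theorem frac_prod_mul (P : Poly V) (k m : Fin n → ℕ) :
    frac α ((∏ i, lin (α i) ^ k i) * P) (m + k) = frac α P m := by
  rw [frac_eq_frac_iff]
  refine ⟨0, ?_⟩
  simp only [Pi.zero_apply, pow_zero, Finset.prod_const_one, one_mul, Pi.add_apply, pow_add,
    Finset.prod_mul_distrib]
  ring

/-- Multiplying numerator and denominator by the same product of the α_i does not change the value,
so it depends on the fraction only. -/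
theorem act_apply_eq_of_frac_eq (w : weights α) {P Q : Poly V} {k l : Fin n → ℕ}
    (h : frac α P k = frac α Q l) : (act α P w).1 k = (act α Q w).1 l := by
  obtain ⟨m, hm⟩ := frac_eq_frac_iff.1 h
  rw [← act_prod_mul_apply_add P w k l, ← act_prod_mul_apply_add Q w l k,
    ← act_prod_mul_apply_add _ w _ m, hm, act_prod_mul_apply_add, add_comm k l,
    act_prod_mul_apply_add]

/-- The linear functional on fractions attached to a weight. -/
theorem exists_functional (w : weights α) :
    ∃ f : FractionAlgebra α →ₗ[ℝ] ℝ, ∀ P m, f (frac α P m) = (act α P w).1 m := by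
  choose P m hPm using exists_eq_frac (α := α)
  have key : ∀ Q k, (act α (P (frac α Q k)) w).1 (m (frac α Q k)) = (act α Q w).1 k :=
    fun Q k => act_apply_eq_of_frac_eq w (hPm _).symm
  refine ⟨⟨⟨fun x => (act α (P x) w).1 (m x), fun x y => ?_⟩, fun t x => ?_⟩, key⟩
  · obtain ⟨Q, k, rfl⟩ := exists_eq_frac x
    obtain ⟨R, l, rfl⟩ := exists_eq_frac y
    rw [frac_add_frac, key, key, key, map_add, LinearMap.add_apply, Submodule.coe_add,
      Pi.add_apply, act_prod_mul_apply_add, add_comm k l, act_prod_mul_apply_add, add_comm]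
  · obtain ⟨Q, k, rfl⟩ := exists_eq_frac x
    rw [← frac_smul]
    refine (key _ _).trans ?_
    rw [map_smul]
    exact congrArg (t • ·) (key Q k).symm

/-- Polynomials act by lowering exponents, so vanishing on a set of exponents closed under decrease
is preserved. -/
theorem act_apply_eq_zero (w : weights α) {p : (Fin n → ℕ) → Prop}
    (hp : ∀ m k, p m → p (m - k)) (hw : ∀ m, p m → w.1 m = 0) (P : Poly V) (m : Fin n → ℕ)
    (hm : p m) : (act α P w).1 m = 0 := by
  induction P using SymmetricAlgebra.induction generalizing w m with
  | algebraMap t =>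
    rw [AlgHom.commutes, Module.algebraMap_end_apply]
    simp [hw m hm]
  | ι β =>
    rw [act_lin]
    change shift α β w m = 0
    by_cases h : IsGenerating α {i | 0 < m i}
    · obtain ⟨x, hx, hβ⟩ := h.exists_coeff β
      rw [shift_eq_sum w.2 hx hβ]
      exact Finset.sum_eq_zero fun i _ => by rw [hw _ (hp m _ hm), mul_zero]
    · exact shift_of_not_isGenerating h β w
  | mul P Q hP hQ =>
    rw [map_mul]
    exact hP (act α Q w) (fun k hk => hQ w hw k hk) m hm
  | add P Q hP hQ =>
    rw [map_add, LinearMap.add_apply, Submodule.coe_add, Pi.add_apply, hP w hw m hm,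
      hQ w hw m hm, add_zero]

/-- A functional that kills `NG_α` and all the `1 / ∏ α_i ^ m_i` is zero. -/
theorem functional_eq_zero {f : FractionAlgebra α →ₗ[ℝ] ℝ}
    (hng : ∀ x ∈ nonGeneratingPart α, f x = 0) (hg : ∀ m, f (frac α 1 m) = 0) : f = 0 := by
  have hng' : ∀ (P : Poly V) (m : Fin n → ℕ), ¬ IsGenerating α {i | 0 < m i} →
      f (frac α P m) = 0 := fun P m hm => hng _ (Submodule.subset_span ⟨P, m, hm, rfl⟩)
  -- The extra factor Q makes the statement stable under products, so induction on P works.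
  have key : ∀ (P Q : Poly V), (∀ m, f (frac α Q m) = 0) → ∀ m, f (frac α (P * Q) m) = 0 := by
    intro P
    induction P using SymmetricAlgebra.induction with
    | algebraMap t =>
      intro Q hQ m
      rw [← Algebra.smul_def, frac_smul, map_smul, hQ, smul_zero]
    | ι β =>
      intro Q hQ m
      by_cases h : IsGenerating α {i | 0 < m i}
      · obtain ⟨x, hx, rfl⟩ := h.exists_coeff β
        have hs : frac α (lin (∑ i, x i • α i) * Q) m =
            ∑ i, x i • frac α (lin (α i) * Q) m := by
          change fracLinearMap α m _ = ∑ i, x i • fracLinearMap α m _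
          simp only [lin, map_sum, map_smul, Finset.sum_mul, smul_mul_assoc]
        rw [hs, map_sum]
        refine Finset.sum_eq_zero fun i _ => ?_
        rw [map_smul]
        by_cases hi : 0 < m i
        · rw [frac_lin_mul hi, hQ, smul_zero]
        · rw [hx i hi, zero_smul]
      · exact hng' _ m h
    | mul P P' hP hP' =>
      intro Q hQ m
      rw [mul_assoc]
      exact hP _ (hP' Q hQ) m
    | add P P' hP hP' =>
      intro Q hQ m
      rw [add_mul, frac_add, map_add, hP Q hQ, hP' Q hQ, add_zero]
  ext x
  obtain ⟨P, m, rfl⟩ := exists_eq_frac x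
  simpa using key P 1 hg m

end Fractions

/-! ### Existence and uniqueness of JK_ε, and its vanishing on the ideal. -/

section Residue

variable {B : LinearMap.BilinForm ℝ (Dual ℝ V)} {α : Fin n → Dual ℝ V} {ε : Dual ℝ V}

/-- The exponent of the squarefree product `∏_{j ∈ J} α_j`. -/
def indicatorExponent (J : Finset (Fin n)) : Fin n → ℕ := fun i => if i ∈ J then 1 else 0

/-- The indices with positive exponent. -/
def exponentSupport (m : Fin n → ℕ) : Finset (Fin n) := Finset.univ.filter fun i => 0 < m i

theorem coe_exponentSupport (m : Fin n → ℕ) : (exponentSupport m : Set (Fin n)) = {i | 0 < m i} := by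
  simp [exponentSupport]

theorem mem_exponentSupport {m : Fin n → ℕ} {i : Fin n} : i ∈ exponentSupport m ↔ 0 < m i := by
  simp [exponentSupport]

@[simp]
theorem exponentSupport_indicatorExponent (J : Finset (Fin n)) :
    exponentSupport (indicatorExponent J) = J := by
  ext i
  by_cases hi : i ∈ J <;> simp [mem_exponentSupport, indicatorExponent, hi]

theorem indicatorExponent_exponentSupport {m : Fin n → ℕ} (hm : ∀ i, m i ≤ 1) :
    indicatorExponent (exponentSupport m) = m := by
  funext i
  have := hm i
  by_cases hi : 0 < m i
  · rw [indicatorExponent, if_pos (mem_exponentSupport.2 hi)]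
    omega
  · rw [indicatorExponent, if_neg (mem_exponentSupport.not.2 hi)]
    omega

theorem prod_pow_indicatorExponent (J : Finset (Fin n)) :
    ∏ i, lin (α i) ^ indicatorExponent J i = ∏ j ∈ J, lin (α j) := by
  simp [indicatorExponent, pow_ite, Finset.prod_ite_mem]

theorem sum_indicatorExponent (J : Finset (Fin n)) : ∑ i, indicatorExponent J i = J.card := by
  simp [indicatorExponent]

theorem indicatorExponent_insert_sub {J : Finset (Fin n)} {i k : Fin n} (hi : i ∉ J)
    (hk : k ∈ J) : indicatorExponent (insert i J) - Pi.single k 1 =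
      indicatorExponent (insert i (J.erase k)) := by
  have hik : i ≠ k := fun h => hi (h ▸ hk)
  funext l
  by_cases hlk : l = k
  · subst hlk
    simp [indicatorExponent, hk, hik.symm]
  · simp [indicatorExponent, hlk]

open Classical in
variable (B α ε) in
/-- The values of `JK_ε` on the fractions `1 / ∏ α_i ^ m_i`. -/
def jkWeight (m : Fin n → ℕ) : ℝ :=
  if (∀ i, m i ≤ 1) ∧ IsBasis α (exponentSupport m) ∧
      ε ∈ cone α (exponentSupport m : Set (Fin n)) then
    1 / Real.sqrt (gramDet B α (exponentSupport m))
  else 0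

theorem jkWeight_of_mem_cone {J : Finset (Fin n)} (hJ : IsBasis α J)
    (h : ε ∈ cone α (J : Set (Fin n))) :
    jkWeight B α ε (indicatorExponent J) = 1 / Real.sqrt (gramDet B α J) := by
  have hle : ∀ i, indicatorExponent J i ≤ 1 := fun i => by
    unfold indicatorExponent
    split_ifs <;> simp
  rw [jkWeight, exponentSupport_indicatorExponent, if_pos ⟨hle, hJ, h⟩]

theorem jkWeight_of_notMem_cone {m : Fin n → ℕ}
    (h : ε ∉ cone α (exponentSupport m : Set (Fin n))) : jkWeight B α ε m = 0 :=
  if_neg fun h' => h h'.2.2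

theorem exists_of_jkWeight_ne_zero {m : Fin n → ℕ} (h : jkWeight B α ε m ≠ 0) :
    ∃ J : Finset (Fin n), IsBasis α J ∧ ε ∈ cone α (J : Set (Fin n)) ∧
      m = indicatorExponent J := by
  unfold jkWeight at h
  split_ifs at h with h'
  · exact ⟨_, h'.2.1, h'.2.2, (indicatorExponent_exponentSupport h'.1).symm⟩
  · exact absurd rfl h

theorem IsJK.unique {f g : FractionAlgebra α →ₗ[ℝ] ℝ} (hf : IsJK B α ε f) (hg : IsJK B α ε g) :
    f = g := by
  rw [← sub_eq_zero]
  refine functional_eq_zero (fun x hx => ?_) fun m => ?_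
  · rw [LinearMap.sub_apply, hf.vanish_nonGenerating x hx, hg.vanish_nonGenerating x hx, sub_zero]
  rw [LinearMap.sub_apply, sub_eq_zero]
  by_cases hm : IsGenerating α {i | 0 < m i}
  swap
  · have hx : frac α 1 m ∈ nonGeneratingPart α := Submodule.subset_span ⟨1, m, hm, rfl⟩
    rw [hf.vanish_nonGenerating _ hx, hg.vanish_nonGenerating _ hx]
  by_cases hd : ∑ i, m i = finrank ℝ V
  swap
  · have hx : frac α 1 m ∈ generatingPart α (∑ i, m i) := Submodule.subset_span ⟨m, hm, rfl, rfl⟩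
    rw [hf.vanish_generating _ hd _ hx, hg.vanish_generating _ hd _ hx]
  rw [← coe_exponentSupport] at hm
  -- A generating support has at least r elements, so total degree r forces all exponents to be at
  -- most 1 and the support to be a basis.
  have hle : ∀ i, indicatorExponent (exponentSupport m) i ≤ m i := fun i => by
    unfold indicatorExponent
    split_ifs with hi
    · exact mem_exponentSupport.1 hi
    · exact Nat.zero_le _
  have hsum : ∑ i, indicatorExponent (exponentSupport m) i = ∑ i, m i := by
    refine le_antisymm (Finset.sum_le_sum fun i _ => hle i) ?_
    rw [hd, sum_indicatorExponent]
    exact finrank_le_card_of_isGenerating hm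
  have hJ : IsBasis α (exponentSupport m) := hm.isBasis (by rw [← sum_indicatorExponent, hsum, hd])
  have hm' : frac α 1 m = basicFraction α (exponentSupport m) := by
    have : indicatorExponent (exponentSupport m) = m := funext fun i =>
      (Finset.sum_eq_sum_iff_of_le fun i _ => hle i).1 hsum i (Finset.mem_univ i)
    conv_lhs => rw [← this]
    rfl
  rw [hm']
  by_cases hc : ε ∈ cone α (exponentSupport m : Set (Fin n))
  · rw [hf.apply_of_mem_cone _ hJ hc, hg.apply_of_mem_cone _ hJ hc]
  · rw [hf.apply_of_notMem_cone _ hJ hc, hg.apply_of_notMem_cone _ hJ hc]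

variable [FiniteDimensional ℝ V]

/-- A nonzero term of a relation comes from a feasible basis J with m - e_i its indicator. The
relation is then c_i times α_i - ∑ a_k α_k = 0, and only the pivot j gives a second feasible term.
With g the Gram determinant of J, the two contributions are c_i/√g and -c_i a_j/(a_j √g). -/
theorem jkWeight_mem_weights {ξ : V} (hξ : ∀ i, 0 < α i ξ) (hε : IsRegular α ε) :
    jkWeight B α ε ∈ weights α := by
  refine ⟨fun m hm => ?_, fun m c hc hsum => ?_⟩
  · by_contra h
    obtain ⟨J, hJ, -, rfl⟩ := exists_of_jkWeight_ne_zero h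
    rw [← coe_exponentSupport, exponentSupport_indicatorExponent] at hm
    exact hm hJ.2
  by_contra hne
  obtain ⟨i, -, hi⟩ := Finset.exists_ne_zero_of_sum_ne_zero hne
  obtain ⟨hci, hwi⟩ := mul_ne_zero_iff.1 hi
  have hmi : 0 < m i := by
    by_contra h
    exact hci (hc i h)
  obtain ⟨J, hJ, hεJ, hm⟩ := exists_of_jkWeight_ne_zero hwi
  have hm' : ∀ k, k ≠ i → (0 < m k ↔ k ∈ J) := fun k hk => by
    have h1 := congrFun hm k
    simp only [Pi.sub_apply, Pi.single_eq_of_ne hk, indicatorExponent, tsub_zero] at h1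
    rw [h1]
    split_ifs with h2 <;> simp [h2]
  -- If i ∈ J, the relation c is supported on the basis J, hence trivial.
  by_cases hiJ : i ∈ J
  · refine hci (congrFun (hJ.coeff_eq_zero (fun k hk => hc k fun h => hk ?_) hsum) i)
    by_cases hki : k = i
    · rwa [hki]
    · exact (hm' k hki).1 h
  have hmJ : m = indicatorExponent (insert i J) := by
    funext k
    have h1 := congrFun hm k
    by_cases hki : k = i
    · subst hki
      simp only [Pi.sub_apply, Pi.single_eq_same, indicatorExponent, if_neg hiJ] at h1
      simp only [indicatorExponent, Finset.mem_insert_self, if_true]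
      omega
    · simpa [Pi.single_eq_of_ne hki, indicatorExponent, hki] using h1
  obtain ⟨x, hx⟩ := hε.exists_isFeasible hJ.card_eq hεJ
  obtain ⟨a, ha, hai⟩ := hJ.2.exists_coeff (α i)
  replace ha : ∀ k ∉ J, a k = 0 := by simpa using ha
  obtain ⟨j, hj, haj, hmin⟩ := hx.exists_ratio hε hξ ha hai
  have hij : i ≠ j := fun h => hiJ (h ▸ hj)
  have hca : ∀ k ∈ J, c k = -(c i * a k) := by
    have h0 : c - Pi.single i (c i) + c i • a = 0 := by
      refine hJ.coeff_eq_zero (fun k hk => ?_) ?_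
      · by_cases hki : k = i
        · subst hki
          simp [ha k hk]
        · simp [hki, ha k hk, hc k ((hm' k hki).not.2 hk)]
      · simp only [Pi.add_apply, Pi.sub_apply, Pi.smul_apply, smul_eq_mul, add_smul, sub_smul,
          Finset.sum_add_distrib, Finset.sum_sub_distrib, mul_smul, ← Finset.smul_sum, ← hai,
          hsum]
        rw [Finset.sum_eq_single i (fun b _ hb => by simp [hb]) (by simp)]
        simp
    intro k hk
    have hki : k ≠ i := fun h => hiJ (h ▸ hk)
    have := congrFun h0 k
    simp only [Pi.add_apply, Pi.sub_apply, Pi.smul_apply, smul_eq_mul, Pi.single_eq_of_ne hki,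
      sub_zero, Pi.zero_apply] at this
    linarith
  refine hne ?_
  rw [Fintype.sum_eq_add i j hij]
  · have hpiv := hx.pivot hε hiJ ha hai hj haj hmin
    rw [hm, jkWeight_of_mem_cone hJ hεJ, hmJ, indicatorExponent_insert_sub hiJ hj,
      jkWeight_of_mem_cone hpiv.isBasis hpiv.mem_cone, gramDet_exchange hiJ hj ha hai,
      Real.sqrt_mul (sq_nonneg _), Real.sqrt_sq haj.le, hca j hj, one_div, one_div, mul_inv]
    field_simp
    simp
  · rintro k ⟨hki, hkj⟩
    by_cases hk : k ∈ J
    · rw [hmJ, indicatorExponent_insert_sub hiJ hk, jkWeight_of_notMem_cone, mul_zero]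
      rw [exponentSupport_indicatorExponent]
      exact hx.notMem_cone_of_ne hiJ ha hai hj hmin hk hkj
    · rw [hc k ((hm' k hki).not.2 hk), zero_mul]

theorem exists_isJK {ξ : V} (hξ : ∀ i, 0 < α i ξ) (hε : IsRegular α ε) :
    ∃ f : FractionAlgebra α →ₗ[ℝ] ℝ, IsJK B α ε f ∧
      ∀ P m, f (frac α P m) = (act α P ⟨jkWeight B α ε, jkWeight_mem_weights hξ hε⟩).1 m := by
  obtain ⟨f, hf⟩ := exists_functional (⟨jkWeight B α ε, jkWeight_mem_weights hξ hε⟩ : weights α)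
  have hf1 : ∀ m, f (frac α 1 m) = jkWeight B α ε m := fun m => by
    rw [hf, map_one]
    rfl
  refine ⟨f, ⟨fun x hx => ?_, fun d hd x hx => ?_, fun J hJ h => ?_, fun J hJ h => ?_⟩, hf⟩
  · induction hx using Submodule.span_induction with
    | mem x hx =>
      obtain ⟨P, m, hm, rfl⟩ := hx
      rw [hf]
      exact (act α P _).2.1 m hm
    | zero => exact map_zero f
    | add x y _ _ hx hy => rw [map_add, hx, hy, add_zero]
    | smul t x _ hx => rw [map_smul, hx, smul_zero]
  · induction hx using Submodule.span_induction with
    | mem x hx =>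
      obtain ⟨m, -, hm, rfl⟩ := hx
      rw [hf1]
      by_contra h
      obtain ⟨J, hJ, -, rfl⟩ := exists_of_jkWeight_ne_zero h
      rw [sum_indicatorExponent, hJ.card_eq] at hm
      exact hd hm.symm
    | zero => exact map_zero f
    | add x y _ _ hx hy => rw [map_add, hx, hy, add_zero]
    | smul t x _ hx => rw [map_smul, hx, smul_zero]
  · exact (hf1 _).trans (jkWeight_of_mem_cone hJ h)
  · refine (hf1 (indicatorExponent J)).trans (jkWeight_of_notMem_cone ?_)
    rwa [exponentSupport_indicatorExponent]

theorem isJK_jk {ξ : V} (hξ : ∀ i, 0 < α i ξ) (hε : IsRegular α ε) :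
    IsJK B α ε (jk B α ε) := by
  obtain ⟨f, hf, -⟩ := exists_isJK (B := B) hξ hε
  have h : ∃ f : FractionAlgebra α →ₗ[ℝ] ℝ, IsJK B α ε f := ⟨f, hf⟩
  rw [jk, dif_pos h]
  exact h.choose_spec

theorem jk_frac {ξ : V} (hξ : ∀ i, 0 < α i ξ) (hε : IsRegular α ε) (P : Poly V)
    (m : Fin n → ℕ) : jk B α ε (frac α P m) =
      (act α P ⟨jkWeight B α ε, jkWeight_mem_weights hξ hε⟩).1 m := by
  obtain ⟨f, hf, hf'⟩ := exists_isJK (B := B) hξ hε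
  rw [(isJK_jk hξ hε).unique hf, hf']

theorem jk_frac_prod_compl_mul {ξ : V} (hξ : ∀ i, 0 < α i ξ) (hε : IsRegular α ε) (P : Poly V)
    (J : Finset (Fin n)) : jk B α ε (frac α ((∏ j ∈ J, lin (α j)) * P) fun _ => 1) =
      (act α P ⟨jkWeight B α ε, jkWeight_mem_weights hξ hε⟩).1 (indicatorExponent Jᶜ) := by
  have : (fun _ => 1 : Fin n → ℕ) = indicatorExponent Jᶜ + indicatorExponent J := by
    funext i
    by_cases hi : i ∈ J <;> simp [indicatorExponent, hi]
  rw [← prod_pow_indicatorExponent, this, frac_prod_mul, jk_frac hξ hε]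

/-- Lowering exponents shrinks the support and hence the cone, so ε stays outside. -/
theorem act_jkWeight_eq_zero {ξ : V} (hξ : ∀ i, 0 < α i ξ) (hε : IsRegular α ε)
    {J : Finset (Fin n)} (hJ : ε ∉ cone α (J : Set (Fin n))) (P : Poly V) :
    (act α P ⟨jkWeight B α ε, jkWeight_mem_weights hξ hε⟩).1 (indicatorExponent J) = 0 := by
  refine act_apply_eq_zero _ (p := fun m => ε ∉ cone α (exponentSupport m : Set (Fin n)))
    ?_ ?_ P _ ?_
  · intro m k hm hmem
    refine hm (cone_mono ?_ hmem)
    rw [coe_exponentSupport, coe_exponentSupport]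
    intro i (hi : 0 < m i - k i)
    exact show 0 < m i by omega
  · intro m hm
    exact jkWeight_of_notMem_cone hm
  · rwa [exponentSupport_indicatorExponent]

theorem jk_eq_zero_of_mem_coneIdeal {ξ : V} (hξ : ∀ i, 0 < α i ξ) (hε : IsRegular α ε)
    {P : Poly V} (hP : P ∈ coneIdeal α ε) : jk B α ε (frac α P fun _ => 1) = 0 := by
  -- The factor Q absorbs the polynomial coefficients in the span induction.
  suffices ∀ Q : Poly V, jk B α ε (frac α (P * Q) fun _ => 1) = 0 by simpa using this 1
  induction hP using Submodule.span_induction with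
  | mem P hP =>
    obtain ⟨J, hJ, rfl⟩ := hP
    intro Q
    rw [jk_frac_prod_compl_mul hξ hε]
    exact act_jkWeight_eq_zero hξ hε (by rwa [Finset.coe_compl]) Q
  | zero =>
    intro Q
    rw [zero_mul]
    exact ((jk B α ε).comp (fracLinearMap α fun _ => 1)).map_zero
  | add P P' _ _ hP hP' =>
    intro Q
    rw [add_mul, frac_add, map_add, hP, hP', add_zero]
  | smul R P _ hP =>
    intro Q
    rw [smul_eq_mul, mul_comm R, mul_assoc]
    exact hP _

theorem jk_frac_prod_compl {ξ : V} (hξ : ∀ i, 0 < α i ξ) (hε : IsRegular α ε)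
    {J : Finset (Fin n)} {x : Fin n → ℝ} (hJ : IsFeasible α ε J x) :
    jk B α ε (frac α (∏ j ∈ Jᶜ, lin (α j)) fun _ => 1) = 1 / Real.sqrt (gramDet B α J) := by
  have h := jk_frac_prod_compl_mul (B := B) hξ hε 1 Jᶜ
  rw [mul_one, compl_compl, map_one] at h
  exact h.trans (jkWeight_of_mem_cone hJ.isBasis hJ.mem_cone)

end Residue

/-! ### The quotient by the ideal in degree n-r is at most one-dimensional. -/

section Ideal

variable {α : Fin n → Dual ℝ V} {ε : Dual ℝ V}

theorem prod_lin_mem_homogeneousPart (J : Finset (Fin n)) :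
    ∏ j ∈ J, lin (α j) ∈ homogeneousPart V J.card := by
  classical
  unfold homogeneousPart
  induction J using Finset.induction_on with
  | empty => simp [Submodule.one_le.1 le_rfl]
  | insert i J hi ih =>
    rw [Finset.prod_insert hi, Finset.card_insert_of_notMem hi, pow_succ']
    exact Submodule.mul_mem_mul (LinearMap.mem_range_self _ _) ih

theorem isHomogeneousIdeal_coneIdeal : IsHomogeneousIdeal (coneIdeal α ε) := by
  refine le_antisymm (Ideal.span_le.2 ?_) (Ideal.span_le.2 fun p hp => hp.1)
  rintro p ⟨J, hJ, rfl⟩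
  exact Ideal.subset_span ⟨Ideal.subset_span ⟨J, hJ, rfl⟩, _, prod_lin_mem_homogeneousPart J⟩

theorem prod_lin_mem_coneIdeal {J : Finset (Fin n)} (hJ : ε ∉ cone α ((J : Set (Fin n))ᶜ)) :
    ∏ j ∈ J, lin (α j) ∈ coneIdeal α ε :=
  Ideal.subset_span ⟨J, hJ, rfl⟩

theorem lin_sum_mul (x : Fin n → ℝ) (P : Poly V) :
    lin (∑ i, x i • α i) * P = ∑ i, x i • (lin (α i) * P) := by
  simp only [lin, map_sum, map_smul, Finset.sum_mul, smul_mul_assoc]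

/-- Neighbouring vertices give proportional classes modulo the ideal. -/
theorem prod_compl_sub_smul_mem {J : Finset (Fin n)} {x : Fin n → ℝ} (hJ : IsFeasible α ε J x)
    {i : Fin n} (hi : i ∉ J) {a : Fin n → ℝ} (ha : ∀ j ∉ J, a j = 0)
    (hai : α i = ∑ j, a j • α j) {j : Fin n} (hj : j ∈ J)
    (hmin : ∀ k ∈ J, k ≠ j → x j * a k < x k * a j) :
    ∏ k ∈ Jᶜ, lin (α k) - a j • ∏ k ∈ (insert i (J.erase j))ᶜ, lin (α k) ∈ coneIdeal α ε := by
  have hcompl : ∀ k ∈ J, (insert i (J.erase k))ᶜ = insert k (insert i J)ᶜ := fun k hk => by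
    have hki : k ≠ i := fun h => hi (h ▸ hk)
    ext l
    by_cases hlk : l = k
    · subst hlk
      simp [hki]
    · simp [hlk]
  have hcompl' : Jᶜ = insert i (insert i J)ᶜ := by
    ext l
    by_cases hli : l = i
    · subst hli
      simp [hi]
    · simp [hli]
  have hprod : ∀ k ∈ J, ∏ l ∈ (insert i (J.erase k))ᶜ, lin (α l) =
      lin (α k) * ∏ l ∈ (insert i J)ᶜ, lin (α l) := fun k hk => by
    rw [hcompl k hk, Finset.prod_insert (by simp [hk])]
  -- Multiply α_i = ∑ a_k α_k by the product over the complement of J ∪ {i}. The term of k is a_k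
  -- times the product over the complement of (J \ k) ∪ {i}, a generator of the ideal unless k = j.
  rw [hcompl', Finset.prod_insert (by simp), hai, lin_sum_mul,
    ← Finset.add_sum_erase _ _ (Finset.mem_univ j), hprod j hj, add_sub_cancel_left]
  refine Ideal.sum_mem _ fun k hk => ?_
  by_cases hkJ : k ∈ J
  · rw [← hprod k hkJ]
    refine Submodule.smul_of_tower_mem _ _ (prod_lin_mem_coneIdeal ?_)
    rw [← Finset.coe_compl, compl_compl]
    exact hJ.notMem_cone_of_ne hi ha hai hj hmin hkJ (Finset.ne_of_mem_erase hk)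
  · rw [ha k hkJ, zero_smul]
    exact Ideal.zero_mem _

variable [FiniteDimensional ℝ V]

/-- Given a squarefree product over J outside the ideal, ε lies in the cone of the complement of J,
which is therefore generating by regularity. Any further linear factor expands in the α_i with i ∉
J, so squarefreeness persists. -/
theorem homogeneousPart_le (hε : IsRegular α ε) (d : ℕ) :
    homogeneousPart V d ≤ (coneIdeal α ε).restrictScalars ℝ ⊔
      Submodule.span ℝ {p | ∃ J : Finset (Fin n), J.card = d ∧ p = ∏ j ∈ J, lin (α j)} := by
  induction d with
  | zero =>
    refine le_sup_of_le_right ?_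
    rw [homogeneousPart, pow_zero, Submodule.one_le]
    exact Submodule.subset_span ⟨∅, by simp⟩
  | succ d ih =>
    rw [homogeneousPart, pow_succ', Submodule.mul_le]
    rintro _ ⟨β, rfl⟩ P hP
    obtain ⟨Q, hQ, R, hR, rfl⟩ := Submodule.mem_sup.1 (ih hP)
    rw [mul_add]
    refine add_mem (Submodule.mem_sup_left (Ideal.mul_mem_left _ _ hQ)) ?_
    clear hP
    induction hR using Submodule.span_induction with
    | mem R hR =>
      obtain ⟨J, hJ, rfl⟩ := hR
      by_cases hc : ε ∈ cone α ((J : Set (Fin n))ᶜ)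
      · obtain ⟨x, hx, rfl⟩ := (hε.isGenerating (cone_le_spanOf hc)).exists_coeff β
        refine Submodule.mem_sup_right ?_
        rw [show SymmetricAlgebra.ι ℝ (Dual ℝ V) (∑ i, x i • α i) = lin (∑ i, x i • α i) from rfl,
          lin_sum_mul]
        refine Submodule.sum_mem _ fun i _ => ?_
        by_cases hi : i ∈ J
        · rw [hx i (by simpa using hi), zero_smul]
          exact Submodule.zero_mem _
        · refine Submodule.smul_mem _ _ (Submodule.subset_span ⟨insert i J, ?_, ?_⟩)
          · rw [Finset.card_insert_of_notMem hi, hJ]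
          · rw [Finset.prod_insert hi]
      · exact Submodule.mem_sup_left (Ideal.mul_mem_left _ _ (prod_lin_mem_coneIdeal hc))
    | zero =>
      rw [mul_zero]
      exact Submodule.zero_mem _
    | add R S _ _ hR hS =>
      rw [mul_add]
      exact add_mem hR hS
    | smul t R _ hR =>
      rw [mul_smul_comm]
      exact Submodule.smul_mem _ _ hR

/-- At a vertex that does not minimise the objective `∑_{i ∉ K} x_i`, some pivot decreases it. -/
theorem IsFeasible.exists_decreasing_pivot (hε : IsRegular α ε) {ξ : V} (hξ : ∀ i, 0 < α i ξ)
    {J K : Finset (Fin n)} {x y : Fin n → ℝ} (hJ : IsFeasible α ε J x) (hK : IsFeasible α ε K y)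
    (hJK : J ≠ K) : ∃ (J' : Finset (Fin n)) (x' : Fin n → ℝ) (t : ℝ), IsFeasible α ε J' x' ∧
      ∑ i ∈ Kᶜ, x' i < ∑ i ∈ Kᶜ, x i ∧
      ∏ k ∈ Jᶜ, lin (α k) - t • ∏ k ∈ J'ᶜ, lin (α k) ∈ coneIdeal α ε := by
  have hcoeff : ∀ i, ∃ a : Fin n → ℝ, (∀ j ∉ J, a j = 0) ∧ α i = ∑ j, a j • α j := fun i => by
    obtain ⟨a, ha, hai⟩ := hJ.isBasis.2.exists_coeff (α i)
    exact ⟨a, by simpa using ha, hai⟩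
  choose a ha hai using hcoeff
  have hxy : x = fun j => ∑ i, y i * a i j := by
    refine hJ.isBasis.coeff_unique hJ.eq_zero (fun j hj => ?_) ?_
    · exact Finset.sum_eq_zero fun i _ => by rw [ha i j hj, mul_zero]
    · rw [← hJ.eq_sum, hK.eq_sum]
      simp only [Finset.sum_smul, mul_smul]
      rw [Finset.sum_comm]
      refine Finset.sum_congr rfl fun i _ => ?_
      rw [← Finset.smul_sum, ← hai]
  have hpos : 0 < ∑ j ∈ Kᶜ, x j := by
    have hnot : ¬ J ⊆ K := fun h => hJK (Finset.eq_of_subset_of_card_le h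
      (by rw [hJ.isBasis.card_eq, hK.isBasis.card_eq]))
    obtain ⟨j, hj, hjK⟩ := Finset.not_subset.1 hnot
    refine Finset.sum_pos' (fun i _ => ?_) ⟨j, Finset.mem_compl.2 hjK, hJ.pos j hj⟩
    by_cases hi : i ∈ J
    · exact (hJ.pos i hi).le
    · exact (hJ.eq_zero i hi).ge
  -- The objective at J equals ∑_{i ∈ K} y_i ∑_{j ∉ K} a_{ij} and is positive, so some inner sum is
  -- positive. Bringing in this i lowers the objective by a positive multiple of that sum; i itself
  -- lies in K and adds nothing.
  obtain ⟨i, hiK, hi⟩ : ∃ i ∈ K, 0 < ∑ j ∈ Kᶜ, a i j := by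
    by_contra! hcon
    rw [hxy, Finset.sum_comm] at hpos
    refine absurd hpos (not_lt.2 (Finset.sum_nonpos fun i _ => ?_))
    rw [← Finset.mul_sum]
    by_cases hiK : i ∈ K
    · exact mul_nonpos_of_nonneg_of_nonpos (hK.pos i hiK).le (hcon i hiK)
    · rw [hK.eq_zero i hiK, zero_mul]
  have hiJ : i ∉ J := by
    intro hiJ
    have hsingle : a i = Pi.single i 1 := by
      refine hJ.isBasis.coeff_unique (ha i) (fun k hk => ?_) ?_
      · exact Pi.single_eq_of_ne (by rintro rfl; exact hk hiJ) _
      · rw [← hai, Finset.sum_eq_single i (fun b _ hb => by simp [hb]) (by simp)]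
        simp
    rw [hsingle, Finset.sum_eq_zero] at hi
    · exact lt_irrefl _ hi
    · intro k hk
      exact Pi.single_eq_of_ne (by rintro rfl; exact Finset.mem_compl.1 hk hiK) _
  obtain ⟨j, hj, haj, hmin⟩ := hJ.exists_ratio hε hξ (ha i) (hai i)
  refine ⟨_, _, a i j, hJ.pivot hε hiJ (ha i) (hai i) hj haj hmin, ?_,
    prod_compl_sub_smul_mem hJ hiJ (ha i) (hai i) hj hmin⟩
  have hsingle : ∑ k ∈ Kᶜ, (Pi.single i (x j / a i j) : Fin n → ℝ) k = 0 :=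
    Finset.sum_eq_zero fun k hk =>
      Pi.single_eq_of_ne (by rintro rfl; exact Finset.mem_compl.1 hk hiK) _
  simp only [Pi.add_apply, Pi.sub_apply, Pi.smul_apply, smul_eq_mul, Finset.sum_add_distrib,
    Finset.sum_sub_distrib, ← Finset.mul_sum, hsingle, add_zero]
  have := mul_pos (div_pos (hJ.pos j hj) haj) hi
  linarith

/-- All vertices give proportional classes modulo the ideal. -/
theorem exists_prod_compl_sub_smul_mem (hε : IsRegular α ε) {ξ : V} (hξ : ∀ i, 0 < α i ξ)
    {J K : Finset (Fin n)} {x y : Fin n → ℝ} (hJ : IsFeasible α ε J x)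
    (hK : IsFeasible α ε K y) :
    ∃ t : ℝ, ∏ k ∈ Jᶜ, lin (α k) - t • ∏ k ∈ Kᶜ, lin (α k) ∈ coneIdeal α ε := by
  classical
  by_contra hcon
  -- Counterexamples are finitely many, since J determines the coordinates of ε. One with minimal
  -- objective is contradicted by a decreasing pivot.
  let S : Set (Finset (Fin n) × (Fin n → ℝ)) := {p | IsFeasible α ε p.1 p.2 ∧
    ¬ ∃ t : ℝ, ∏ k ∈ p.1ᶜ, lin (α k) - t • ∏ k ∈ Kᶜ, lin (α k) ∈ coneIdeal α ε}
  have hfin : S.Finite := by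
    refine Set.Finite.of_finite_image (f := Prod.fst) (Set.toFinite _) ?_
    rintro ⟨J, x⟩ ⟨h, -⟩ ⟨J', x'⟩ ⟨h', -⟩ (rfl : J = J')
    exact Prod.ext rfl
      (h.isBasis.coeff_unique h.eq_zero h'.eq_zero (h.eq_sum.symm.trans h'.eq_sum))
  obtain ⟨⟨J, x⟩, ⟨hJ, hJt⟩, hmin⟩ :=
    Set.exists_min_image S (fun p => ∑ i ∈ Kᶜ, p.2 i) hfin ⟨(J, x), hJ, hcon⟩
  by_cases hJK : J = K
  · subst hJK
    exact hJt ⟨1, by simp⟩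
  obtain ⟨J', x', t, hJ', hlt, ht⟩ := hJ.exists_decreasing_pivot hε hξ hK hJK
  refine absurd (hmin (J', x') ⟨hJ', fun ⟨s, hs⟩ => hJt ⟨t * s, ?_⟩⟩) (not_le.2 hlt)
  have := Ideal.add_mem _ ht (Submodule.smul_of_tower_mem _ t hs)
  rwa [smul_sub, smul_smul, sub_add_sub_cancel] at this

theorem jk_eq_zero_iff {B : LinearMap.BilinForm ℝ (Dual ℝ V)} (hBsymm : B.IsSymm)
    (hBpos : ∀ β : Dual ℝ V, β ≠ 0 → 0 < B β β) (hε : IsRegular α ε) {ξ : V}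
    (hξ : ∀ i, 0 < α i ξ) {d : ℕ} (hd : d + finrank ℝ V = n) {P : Poly V}
    (hP : P ∈ homogeneousPart V d) :
    jk B α ε (frac α P fun _ => 1) = 0 ↔ P ∈ coneIdeal α ε := by
  refine ⟨fun h => ?_, jk_eq_zero_of_mem_coneIdeal hξ hε⟩
  have hcard : ∀ J : Finset (Fin n), J.card = d → Jᶜ.card = finrank ℝ V := fun J hJ => by
    rw [Finset.card_compl, Fintype.card_fin]
    omega
  have hfeas : ∀ J : Finset (Fin n), J.card = d → ∏ j ∈ J, lin (α j) ∉ coneIdeal α ε →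
      ∃ x, IsFeasible α ε Jᶜ x := fun J hJ hmem => by
    refine hε.exists_isFeasible (hcard J hJ) ?_
    by_contra hc
    rw [Finset.coe_compl] at hc
    exact hmem (prod_lin_mem_coneIdeal hc)
  by_cases hex : ∃ K y, IsFeasible α ε K y
  · obtain ⟨K, y, hK⟩ := hex
    have hle : homogeneousPart V d ≤ (coneIdeal α ε).restrictScalars ℝ ⊔
        Submodule.span ℝ {∏ k ∈ Kᶜ, lin (α k)} := by
      refine (homogeneousPart_le hε d).trans (sup_le le_sup_left (Submodule.span_le.2 ?_))
      rintro _ ⟨J, hJ, rfl⟩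
      by_cases hmem : ∏ j ∈ J, lin (α j) ∈ coneIdeal α ε
      · exact Submodule.mem_sup_left hmem
      obtain ⟨x, hx⟩ := hfeas J hJ hmem
      obtain ⟨t, ht⟩ := exists_prod_compl_sub_smul_mem hε hξ hx hK
      rw [compl_compl] at ht
      exact Submodule.mem_sup.2
        ⟨_, ht, _, Submodule.smul_mem _ t (Submodule.mem_span_singleton_self _), by simp⟩
    obtain ⟨Q, hQ, R, hR, rfl⟩ := Submodule.mem_sup.1 (hle hP)
    obtain ⟨t, rfl⟩ := Submodule.mem_span_singleton.1 hR
    rw [frac_add, map_add, jk_eq_zero_of_mem_coneIdeal hξ hε hQ, zero_add, frac_smul, map_smul,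
      jk_frac_prod_compl hξ hε hK, smul_eq_mul, mul_eq_zero] at h
    have hg := Real.sqrt_pos.2 (gramDet_pos hBsymm hBpos hK.isBasis.1)
    rw [h.resolve_right (one_div_pos.2 hg).ne', zero_smul, add_zero]
    exact hQ
  · have hle : homogeneousPart V d ≤ (coneIdeal α ε).restrictScalars ℝ := by
      refine (homogeneousPart_le hε d).trans (sup_le le_rfl (Submodule.span_le.2 ?_))
      rintro _ ⟨J, hJ, rfl⟩
      by_contra hmem
      obtain ⟨x, hx⟩ := hfeas J hJ hmem
      exact hex ⟨_, x, hx⟩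
    exact hle hP

end Ideal

/-! ### Farkas' lemma and the half-space description of the ideal. -/

section HalfSpaces

/-- **Farkas' lemma** for finitely many vectors. -/
theorem exists_dual_of_forall_ne_sum {ι W : Type*} [AddCommGroup W] [Module ℝ W] (K : Finset ι)
    (v : ι → W) (x : W) (h : ∀ y : ι → ℝ, (∀ i, 0 ≤ y i) → x ≠ ∑ i ∈ K, y i • v i) :
    ∃ ℓ : Dual ℝ W, (∀ i ∈ K, ℓ (v i) ≤ 0) ∧ 0 < ℓ x := by
  classical
  induction K using Finset.induction_on generalizing v x with
  | empty =>
    have hx : x ≠ 0 := by simpa using h 0 (fun _ => le_rfl)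
    obtain ⟨ℓ, hℓ⟩ : ∃ ℓ : Dual ℝ W, ℓ x ≠ 0 := by
      by_contra! hcon
      exact hx ((Module.forall_dual_apply_eq_zero_iff ℝ x).1 hcon)
    exact ⟨ℓ x • ℓ, by simp, by simpa using mul_self_pos.2 hℓ⟩
  | insert k K hk ih =>
    obtain ⟨ℓ, hℓ, hℓx⟩ := ih v x fun y hy hsum =>
      h (Function.update y k 0) (fun i => by
        by_cases hik : i = k
        · subst hik; simp
        · simpa [hik] using hy i) (by
        rw [Finset.sum_insert hk, Function.update_self, zero_smul, zero_add, hsum]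
        exact Finset.sum_congr rfl fun i hi => by
          rw [Function.update_of_ne (by rintro rfl; exact hk hi)])
    by_cases hℓk : ℓ (v k) ≤ 0
    · exact ⟨ℓ, by simpa [hℓk] using hℓ, hℓx⟩
    rw [not_le] at hℓk
    -- The projection onto ker ℓ along v_k. If π x were a nonnegative combination of the π v_i, then
    -- x would be one of the v_i and v_k: the coefficient of v_k is nonnegative because ℓ is
    -- positive on x and v_k and nonpositive on the other v_i.
    let π : W →ₗ[ℝ] W := LinearMap.id - (ℓ.smulRight ((ℓ (v k))⁻¹ • v k))
    have hπ : ∀ w, π w = w - (ℓ w / ℓ (v k)) • v k := fun w => by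
      simp [π, smul_smul, div_eq_mul_inv]
    obtain ⟨ℓ', hℓ', hℓx'⟩ := ih (fun i => π (v i)) (π x) fun y hy hsum => by
      refine h (Function.update y k ((ℓ x - ∑ i ∈ K, y i * ℓ (v i)) / ℓ (v k))) (fun i => ?_) ?_
      · by_cases hik : i = k
        · subst hik
          rw [Function.update_self]
          refine div_nonneg (sub_nonneg.2 (le_trans ?_ hℓx.le)) hℓk.le
          exact Finset.sum_nonpos fun j hj =>
            mul_nonpos_of_nonneg_of_nonpos (hy j) (hℓ j hj)
        · simpa [hik] using hy i
      · have h1 : ∑ i ∈ K, Function.update y k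
            ((ℓ x - ∑ i ∈ K, y i * ℓ (v i)) / ℓ (v k)) i • v i = ∑ i ∈ K, y i • v i :=
          Finset.sum_congr rfl fun i hi => by
            rw [Function.update_of_ne (by rintro rfl; exact hk hi)]
        rw [Finset.sum_insert hk, Function.update_self, h1]
        rw [hπ, sub_eq_iff_eq_add] at hsum
        refine hsum.trans ?_
        simp only [hπ, smul_sub, Finset.sum_sub_distrib, smul_smul, sub_div, sub_smul,
          Finset.sum_div, Finset.sum_smul, mul_div_assoc]
        abel
    refine ⟨ℓ' ∘ₗ π, fun i hi => ?_, hℓx'⟩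
    rcases Finset.mem_insert.1 hi with rfl | hi
    · have : π (v i) = 0 := by rw [hπ, div_self hℓk.ne', one_smul, sub_self]
      simp [this]
    · exact hℓ' i hi

variable {α : Fin n → Dual ℝ V} {ε : Dual ℝ V} [FiniteDimensional ℝ V]

/-- While the α_i in ker ℓ do not span it, there is a nonzero g vanishing on them and on ε. Moving ℓ
along g keeps ℓ(ε) and the old zeros and gains a new one, so the codimension of the span drops. -/
theorem exists_isSpannedHyperplane (hα : IsGenerating α Set.univ) {K : Set (Fin n)}
    {ℓ : Dual ℝ (Dual ℝ V)} (hK : ∀ i ∈ K, ℓ (α i) ≤ 0) (hℓ : 0 < ℓ ε) :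
    ∃ ℓ' : Dual ℝ (Dual ℝ V), (∀ i ∈ K, ℓ' (α i) ≤ 0) ∧ 0 < ℓ' ε ∧
      IsSpannedHyperplane α (LinearMap.ker ℓ') := by
  classical
  obtain ⟨N, hN⟩ : ∃ N, finrank ℝ V - finrank ℝ (spanOf α {i | ℓ (α i) = 0}) = N := ⟨_, rfl⟩
  induction N using Nat.strong_induction_on generalizing ℓ with
  | _ N ih =>
  have hne : ℓ ≠ 0 := by
    rintro rfl
    exact lt_irrefl _ hℓ
  have hker : finrank ℝ (LinearMap.ker ℓ) + 1 = finrank ℝ V := by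
    rw [← Subspace.dual_finrank_eq (K := ℝ) (V := V)]
    exact Module.Dual.finrank_ker_add_one_of_ne_zero hne
  have hle : spanOf α {i | ℓ (α i) = 0} ≤ LinearMap.ker ℓ := by
    refine Submodule.span_le.2 ?_
    rintro _ ⟨i, hi, rfl⟩
    exact hi
  by_cases heq : spanOf α {i | ℓ (α i) = 0} = LinearMap.ker ℓ
  · exact ⟨ℓ, hK, hℓ, hker, _, heq.symm⟩
  have hlt := Submodule.finrank_lt_finrank_of_lt (lt_of_le_of_ne hle heq)
  have htop : spanOf α {i | ℓ (α i) = 0} ⊔ Submodule.span ℝ {ε} < ⊤ := by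
    refine lt_top_iff_ne_top.2 fun htop => ?_
    have h1 := Submodule.finrank_add_le_finrank_add_finrank
      (spanOf α {i | ℓ (α i) = 0}) (Submodule.span ℝ {ε})
    have h2 : finrank ℝ (Submodule.span ℝ {ε}) ≤ 1 := by
      simpa using finrank_span_le_card (R := ℝ) ({ε} : Set (Dual ℝ V))
    rw [htop, finrank_top, Subspace.dual_finrank_eq] at h1
    omega
  obtain ⟨g, hg0, hg⟩ := Submodule.exists_le_ker_of_lt_top _ htop
  have hgε : g ε = 0 := hg (Submodule.mem_sup_right (Submodule.mem_span_singleton_self ε))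
  have hgspan : ∀ β ∈ spanOf α {i | ℓ (α i) = 0}, g β = 0 := fun β hβ =>
    hg (Submodule.mem_sup_left hβ)
  have hnonempty : (Finset.univ.filter fun i => g (α i) ≠ 0).Nonempty := by
    by_contra hcon
    rw [Finset.not_nonempty_iff_eq_empty, Finset.filter_eq_empty_iff] at hcon
    refine hg0 (LinearMap.ext fun β => ?_)
    obtain ⟨x, -, rfl⟩ := hα.exists_coeff β
    rw [map_sum, LinearMap.zero_apply]
    refine Finset.sum_eq_zero fun i _ => ?_
    rw [map_smul, not_not.1 (hcon (Finset.mem_univ i)), smul_zero]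
  -- The smallest step, in absolute value, at which a new α_k enters the kernel. By minimality no
  -- ℓ(α_i) changes sign.
  obtain ⟨k, hk, hmin⟩ := Finset.exists_min_image _ (fun i => |ℓ (α i) / g (α i)|) hnonempty
  have hgk : g (α k) ≠ 0 := (Finset.mem_filter.1 hk).2
  let t : ℝ := ℓ (α k) / g (α k)
  have hlt' : spanOf α {i | ℓ (α i) = 0} < spanOf α {i | (ℓ - t • g) (α i) = 0} := by
    refine lt_of_le_of_ne (Submodule.span_mono (Set.image_mono fun i hi => ?_)) fun h => ?_
    · have h1 : ℓ (α i) = 0 := hi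
      have h2 : g (α i) = 0 := hgspan _ (Submodule.subset_span ⟨i, hi, rfl⟩)
      simp [h1, h2]
    · refine hgk (hgspan _ (h.symm ▸ Submodule.subset_span ⟨k, ?_, rfl⟩))
      simp [t, hgk]
  have hdim := Submodule.finrank_lt_finrank_of_lt hlt'
  have hdim' := Submodule.finrank_le (spanOf α {i | (ℓ - t • g) (α i) = 0})
  rw [Subspace.dual_finrank_eq] at hdim'
  refine ih _ (by omega) (ℓ := ℓ - t • g) (fun i hi => ?_) (by simpa [hgε] using hℓ) rfl
  have hi0 := hK i hi
  simp only [LinearMap.sub_apply, LinearMap.smul_apply, smul_eq_mul]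
  by_cases hgi : g (α i) = 0
  · simpa [hgi] using hi0
  · have h1 : |t| ≤ |ℓ (α i) / g (α i)| := hmin i (by simp [hgi])
    rw [abs_div (ℓ (α i)), le_div_iff₀ (abs_pos.2 hgi), ← abs_mul, abs_of_nonpos hi0] at h1
    have := neg_abs_le (t * g (α i))
    linarith

theorem coneIdeal_eq_halfSpaceIdeal (hα : IsGenerating α Set.univ) :
    coneIdeal α ε = halfSpaceIdeal α ε := by
  classical
  refine le_antisymm (Ideal.span_le.2 ?_) (Ideal.span_le.2 ?_)
  · rintro _ ⟨J, hJ, rfl⟩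
    obtain ⟨ℓ, hℓ, hℓε⟩ := exists_dual_of_forall_ne_sum Jᶜ α ε fun y hy hsum =>
      hJ (mem_cone_iff.2 ⟨fun i => if i ∈ J then 0 else y i, fun i => by
        dsimp only
        split_ifs
        exacts [le_rfl, hy i], fun i hi => by
        rw [Set.mem_compl_iff, not_not] at hi
        exact if_pos hi, by
        rw [hsum, ← Finset.sum_subset (Finset.subset_univ Jᶜ)]
        · exact Finset.sum_congr rfl fun i hi => by simp [Finset.mem_compl.1 hi]
        · intro i _ hi
          rw [Finset.mem_compl, not_not] at hi
          simp [hi]⟩)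
    obtain ⟨ℓ', hℓ', hℓε', hH⟩ := exists_isSpannedHyperplane (K := (Jᶜ : Finset (Fin n))) hα
      (by simpa using hℓ) hℓε
    -- Every α_i in the open half-space has i ∈ J, so the half-space product divides the given
    -- generator.
    have hsub : (Finset.univ.filter fun i => 0 < ℓ' (α i)) ⊆ J := fun i hi => by
      by_contra hiJ
      exact absurd (hℓ' i (by simpa using hiJ)) (not_le.2 (Finset.mem_filter.1 hi).2)
    rw [SetLike.mem_coe, ← Finset.prod_sdiff hsub]
    refine Ideal.mul_mem_left _ _ (Ideal.subset_span
      ⟨_, {β | 0 < ℓ' β}, _, hH, ⟨ℓ', rfl, hℓε', rfl⟩, fun i => ?_, rfl⟩)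
    simp
  · rintro _ ⟨H, U, J, -, ⟨ℓ, -, hℓ, rfl⟩, hJ, rfl⟩
    refine prod_lin_mem_coneIdeal fun hmem => ?_
    obtain ⟨x, hx0, hx, hsum⟩ := mem_cone_iff.1 hmem
    rw [hsum, map_sum] at hℓ
    refine absurd hℓ (not_lt.2 (Finset.sum_nonpos fun i _ => ?_))
    rw [map_smul, smul_eq_mul]
    by_cases hi : i ∈ J
    · rw [hx i (by simpa using hi), zero_mul]
    · exact mul_nonpos_of_nonneg_of_nonpos (hx0 i) (not_lt.1 fun h => hi ((hJ i).2 h))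

end HalfSpaces

end

end JeffreyKirwan

theorem mainTheorem1 {V : Type*} [AddCommGroup V] [Module ℝ V] [FiniteDimensional ℝ V]
    [TopologicalSpace V] [IsTopologicalAddGroup V] [ContinuousSMul ℝ V] [T2Space V]
    (B : LinearMap.BilinForm ℝ (Module.Dual ℝ V)) (hBsymm : B.IsSymm)
    (hBpos : ∀ β : Module.Dual ℝ V, β ≠ 0 → 0 < B β β)
    {n : ℕ} (α : Fin n → Module.Dual ℝ V)
    (Λ : Set V) (hΛ : JeffreyKirwan.IsComponent α Λ)
    (hpol : ∀ i, α i ∈ JeffreyKirwan.dualCone Λ)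
    (ε : Module.Dual ℝ V) (hε : JeffreyKirwan.IsRegular α ε) :
    -- the functional `JK_ε` is well defined
    (∃! f : JeffreyKirwan.FractionAlgebra α →ₗ[ℝ] ℝ, JeffreyKirwan.IsJK B α ε f) ∧
    JeffreyKirwan.IsJK B α ε (JeffreyKirwan.jk B α ε) ∧
    -- its kernel in degree `n - r`
    JeffreyKirwan.IsHomogeneousIdeal (JeffreyKirwan.coneIdeal α ε) ∧
    (∀ d : ℕ, d + Module.finrank ℝ V = n → ∀ P ∈ JeffreyKirwan.homogeneousPart V d,
      (JeffreyKirwan.jk B α ε (JeffreyKirwan.frac α P fun _ => 1) = 0 ↔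
        P ∈ JeffreyKirwan.coneIdeal α ε)) ∧
    -- the geometric description of the ideal
    (JeffreyKirwan.IsGenerating α Set.univ →
      JeffreyKirwan.coneIdeal α ε = JeffreyKirwan.halfSpaceIdeal α ε) := by
  obtain ⟨ξ, hξ, rfl⟩ := hΛ
  -- All that is needed of the polarization is one point where every α_i is positive.
  have hpos : ∀ i, 0 < α i ξ := fun i => hpol i ξ (mem_connectedComponentIn hξ)
  have hjk := JeffreyKirwan.isJK_jk (B := B) hpos hε
  exact ⟨⟨_, hjk, fun f hf => hf.unique hjk⟩, hjk, JeffreyKirwan.isHomogeneousIdeal_coneIdeal,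
    fun d hd P hP => JeffreyKirwan.jk_eq_zero_iff hBsymm hBpos hε hpos hd hP,
    JeffreyKirwan.coneIdeal_eq_halfSpaceIdeal⟩
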